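/- Conventions. A partition of length $\ell$ is a weakly decreasing sequence $\lambda=(\lambda_1\ge\dots\ge\lambda_\ell\ge 0)$ of integers (parts equal to $0$ are allowed and counted in the length), $|\lambda|=\sum_i\lambda_i$, and $m_k(\lambda)=\#\{i:\lambda_i=k\}$. The Littlewood--Richardson coefficients $c^\lambda_{\mu\nu}$ are defined by the product of Schur functions $s_\mu s_\nu=\sum_\lambda c^\lambda_{\mu\nu}s_\lambda$ (zero parts being ignored). The model. Let $\mathcal F\otimes\mathcal B$ be the space with basis $|a\rangle\otimes|m\rangle$, where $a=(a_0,a_1,\dots)$, $a_i\in\{0,1\}$, and $m=(m_0,m_1,\dots)$, $m_i\in\mathbb Z_{\ge0}$, have only finitely many non-zero entries; $\langle a|\otimes\langle m|$ denotes the dual basis. At site $i$ let $\phi_i^\dagger|m_i\rangle=|m_i+1\rangle$, $\phi_i|m_i\rangle=|m_i-1\rangle$ (with $\phi_i|0\rangle=0$) on the $i$-th entry of $m$, and $\psi_i^\dagger|0\rangle=|1\rangle$, $\psi_i^\dagger|1\rangle=0$, $\psi_i|1\rangle=|0\rangle$, $\psi_i|0\rangle=0$, $\pi_i=|0\rangle\langle0|$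 on the $i$-th entry of $a$; operators at different sites commute. Put $$L^*_i(x)=\begin{pmatrix}1& x\,\phi_i^\dagger & x\,\psi_i^\dagger\\ \pi_i\phi_i & x\,\pi_i & 0\\ \psi_i & x\,\psi_i\phi_i^\dagger & x\,\pi_i\end{pmatrix},\qquad T^*(x)=L^*_0(x)L^*_1(x)L^*_2(x)\cdots,$$ and let $T^*_\circ(x)$ and $T^*_\bullet(x)$ be the $(1,1)$ and $(3,1)$ entries of $T^*(x)$; on each basis vector the infinite product for these entries stabilizes. Theorem. Let $\lambda,\mu,\nu$ be partitions of the same length $\ell\ge1$ with $|\lambda|=|\mu|+|\nu|$, and let $L=\lambda_1$ be the largest part of $\lambda$. Let $\kappa=\{\,i+L+1-\nu_i : 1\le i\le\ell\,\}$ and, for indeterminates $x=(x_1,\dots,x_{\ell+L+1})$, $$\mathcal C^\lambda_{\mu\nu}(x)=\langle 0|\otimes\langle\vec\mu|\;\prod_{i=1}^{\ell+L+1}\begin{Bmatrix}T^*_\circ(x_i),& i\in\kappa\\ T^*_\bullet(x_i),& i\notin\kappa\end{Bmatrix}\;|1\rangle\otimes|\vec\lambda\rangle ,$$ with the factors ordered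 from left to right by increasing $i$. Here $|\vec\lambda\rangle$ is the basis vector with $m_k=m_k(\lambda)$ (and likewise $\langle\vec\mu|$), $\langle 0|$ is the fermionic state with all sites empty, and $|1\rangle$ is the one in which exactly the sites $0,1,\dots,L$ are occupied. Put $p_i=\#\{j : i<j\le \ell+L+1,\ j\notin\kappa\}$. Then $$\mathcal C^\lambda_{\mu\nu}(x)=c^\lambda_{\mu\nu}\prod_{i=1}^{\ell+L+1}x_i^{p_i},\qquad\text{equivalently}\qquad c^\lambda_{\mu\nu}=\Bigl(\prod_{i=1}^{\ell+L+1}x_i^{-p_i}\Bigr)\,\mathcal C^\lambda_{\mu\nu}(x)$$ (the coefficient may be zero). -/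

import Mathlib

noncomputable section

namespace FermionBoson

/-! ### The fermion-boson Fock space

A basis vector of `𝓕 ⊗ 𝓑` on the lattice with sites `0, 1, 2, …` is a pair: the finite set of sites
that carry a fermion, and the finitely supported family of boson occupation numbers. -/

abbrev Config : Type := Finset ℕ × (ℕ →₀ ℕ)

/-- The space `𝓕 ⊗ 𝓑` over `R`: the free module on the configurations. -/
abbrev Fock (R : Type*) [CommRing R] : Type _ := Config →₀ R

variable (R : Type*) [CommRing R]

/-- The basis vector `|a⟩ ⊗ |m⟩`. -/
def ket (s : Config) : Fock R := Finsupp.single s 1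

/-- The linear operator with prescribed values on the basis vectors. -/
def ofKet (f : Config → Fock R) : Module.End R (Fock R) := Finsupp.linearCombination R f

/-- `φ†` at site `i` (value at `t = 0`): `|m⟩ ↦ |m + 1⟩`. -/
def bosonCreate (i : ℕ) : Module.End R (Fock R) :=
  ofKet R fun s => ket R (s.1, s.2 + Finsupp.single i 1)

/-- `φ` at site `i`: `|m⟩ ↦ |m - 1⟩` for `m > 0`, and `|0⟩ ↦ 0`. -/
def bosonAnnihilate (i : ℕ) : Module.End R (Fock R) :=
  ofKet R fun s => if s.2 i = 0 then 0 else ket R (s.1, s.2 - Finsupp.single i 1)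

/-- `ψ†` at site `i` (value at `t = 0`): `|0⟩ ↦ |1⟩`, `|1⟩ ↦ 0`. -/
def fermionCreate (i : ℕ) : Module.End R (Fock R) :=
  ofKet R fun s => if i ∈ s.1 then 0 else ket R (insert i s.1, s.2)

/-- `ψ` at site `i`: `|1⟩ ↦ |0⟩`, `|0⟩ ↦ 0`. -/
def fermionAnnihilate (i : ℕ) : Module.End R (Fock R) :=
  ofKet R fun s => if i ∈ s.1 then ket R (s.1.erase i, s.2) else 0

/-- `π = |0⟩⟨0|` on the fermion at site `i`. -/
def fermionVacuum (i : ℕ) : Module.End R (Fock R) :=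
  ofKet R fun s => if i ∈ s.1 then 0 else ket R s

variable {R}

/-- The `L`-matrix `L*(x)` at site `i`, for `t = 0`. The auxiliary indices `0, 1, 2` stand for an
edge that is empty (`∘`), carries a boson line (black), carries a fermion line (red). -/
def lMatrix (x : R) (i : ℕ) : Matrix (Fin 3) (Fin 3) (Module.End R (Fock R)) :=
  !![1, x • bosonCreate R i, x • fermionCreate R i;
     fermionVacuum R i * bosonAnnihilate R i, x • fermionVacuum R i, 0;
     fermionAnnihilate R i, x • (fermionAnnihilate R i * bosonCreate R i), x • fermionVacuum R i]

/-- The product `L*(x)_0 L*(x)_1 ⋯ L*(x)_{n-1}` over the first `n` sites. -/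
def monodromy (x : R) : ℕ → Matrix (Fin 3) (Fin 3) (Module.End R (Fock R))
  | 0 => 1
  | n + 1 => monodromy x n * lMatrix x n

/-- The least `n` such that all sites `i ≥ n` are empty. -/
def width (s : Config) : ℕ := s.1.sup (· + 1) ⊔ s.2.support.sup (· + 1)

/-- The first column of the monodromy matrix over all sites `0, 1, 2, …`: `rowOp 0 x = T*_∘(x)` and
`rowOp 2 x = T*_•(x)` for the red bullet. On a given basis vector the infinite product stabilizes
once the empty sites are reached; see `monodromy_apply_ket`. -/
def rowOp (k : Fin 3) (x : R) : Module.End R (Fock R) :=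
  ofKet R fun s => monodromy x (width s) k 0 (ket R s)

lemma ofKet_ket (f : Config → Fock R) (s : Config) : ofKet R f (ket R s) = f s := by
  simp [ofKet, ket]

theorem monodromy_apply_ket (k : Fin 3) (x : R) (s : Config) {n : ℕ} (hn : width s ≤ n) :
    monodromy x n k 0 (ket R s) = rowOp k x (ket R s) := by
  induction n, hn using Nat.le_induction with
  | base => simp [rowOp, ofKet_ket]
  | succ n hn ih =>
    have h1 : n ∉ s.1 := fun h => by
      have h2 : n + 1 ≤ s.1.sup (· + 1) := Finset.le_sup (f := (· + 1)) h
      have h3 := h2.trans (le_sup_left.trans hn)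
      omega
    have h2 : s.2 n = 0 := by
      by_contra h
      have h2 : n + 1 ≤ s.2.support.sup (· + 1) :=
        Finset.le_sup (f := (· + 1)) (Finsupp.mem_support_iff.2 h)
      have h3 := h2.trans (le_sup_right.trans hn)
      omega
    rw [← ih]
    simp [monodromy, Matrix.mul_apply, Fin.sum_univ_three, lMatrix, bosonAnnihilate,
      fermionAnnihilate, ofKet_ket, h1, h2]

/-- The basis vector of `𝓑` given by a partition: its part multiplicities `m_0, m_1, m_2, …`
(parts equal to zero are counted). -/
def bosonState {ℓ : ℕ} (lam : Fin ℓ → ℕ) : ℕ →₀ ℕ := ∑ i, Finsupp.single (lam i) 1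

/-- The set `κ = {i + L + 1 - ν_i : 1 ≤ i ≤ ℓ}`, where `ν_i` is `nu (i - 1)`. -/
def kappa {ℓ : ℕ} (L : ℕ) (nu : Fin ℓ → ℕ) : Finset ℤ :=
  Finset.univ.image fun i : Fin ℓ => ((i : ℕ) : ℤ) + 1 + L + 1 - (nu i : ℤ)

/-- The partition function `⟨0| ⊗ ⟨μ| ∏_i T*(x_i) |1⟩ ⊗ |λ⟩`, where `T*(x_i)` is `T*_∘` for `i ∈ κ`
and the red `T*_•` for `i ∉ κ`, `|0⟩` is the state without fermions, and `|1⟩` has the sites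
`0, …, L` occupied. The variable `X i` stands for `x_{i+1}`; the factor with `x_1` is leftmost. -/
def partitionFunction {ℓ : ℕ} (L : ℕ) (lam mu nu : Fin ℓ → ℕ) :
    MvPolynomial (Fin (ℓ + L + 1)) ℤ :=
  ((List.ofFn fun i : Fin (ℓ + L + 1) =>
      rowOp (if ((i : ℕ) : ℤ) + 1 ∈ kappa L nu then 0 else 2)
        (MvPolynomial.X i : MvPolynomial (Fin (ℓ + L + 1)) ℤ)).prod
    (ket _ (Finset.range (L + 1), bosonState lam))) (∅, bosonState mu)

/-- The exponent `p_i = #{j > i : j ∉ κ}`. -/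
def exponent {ℓ : ℕ} (L : ℕ) (nu : Fin ℓ → ℕ) (i : Fin (ℓ + L + 1)) : ℕ :=
  (Finset.univ.filter fun j : Fin (ℓ + L + 1) => i < j ∧ ((j : ℕ) : ℤ) + 1 ∉ kappa L nu).card

end FermionBoson

namespace SchurFunction

/-- The alternant `det (x_i ^ (α_j + n - j))`, `1 ≤ i, j ≤ n`, with `α_j` written `α (j - 1)`. -/
def alternant (n : ℕ) (α : ℕ → ℕ) : MvPolynomial (Fin n) ℤ :=
  (Matrix.of fun i j : Fin n => MvPolynomial.X i ^ (α j + (n - 1 - (j : ℕ)))).det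

/-- The Schur polynomial `s_ρ(x_1, …, x_n)`: the quotient of the alternant of `ρ` by the
Vandermonde determinant, and zero if `ρ` has more than `n` rows. -/
def schur (n : ℕ) (ρ : YoungDiagram) : FractionRing (MvPolynomial (Fin n) ℤ) :=
  if ρ.colLen 0 ≤ n then
    algebraMap _ _ (alternant n ρ.rowLen) / algebraMap _ _ (alternant n 0)
  else 0

/-- `c` is the family of coefficients in `s_μ s_ν = ∑_ρ c_ρ s_ρ`, an identity of symmetric
functions, that is, in any number of variables. -/
def IsExpansion (μ ν : YoungDiagram) (c : YoungDiagram →₀ ℤ) : Prop :=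
  ∀ n : ℕ, schur n μ * schur n ν = c.sum fun ρ a => a • schur n ρ

open Classical in
/-- The Littlewood-Richardson coefficient `c^λ_{μν}`: the coefficient of `s_λ` in `s_μ s_ν`. (The
Schur functions are a `ℤ`-basis of the ring of symmetric functions, so that the expansion exists
and is unique.) -/
def lrCoeff (lam μ ν : YoungDiagram) : ℤ :=
  if h : ∃ c, IsExpansion μ ν c then h.choose lam else 0

/-- The diagram of a weakly decreasing sequence; zero parts are dropped. -/
def diagram {ℓ : ℕ} (lam : Fin ℓ → ℕ) (h : Antitone lam) : YoungDiagram :=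
  YoungDiagram.ofRowLens (List.ofFn lam) h.sortedGE_ofFn

end SchurFunction

end

/-!
The product of transfer matrices is evaluated by moving all the factors `T*_∘` to the left.

* *Exchange.* The matrix `L*` satisfies a Yang–Baxter relation (`intertwined_monodromy`), one
  component of which exchanges a `T*_•` with a `T*_∘` on its right (`monodromy_exchange`). After
  division by the monomial `∏ x_i ^ p_i` it reads as the recursion of divided differences in the
  variables `x_i⁻¹`.
* *Base case.* If the factors `T*_∘` are the first `ℓ` ones, the factors `T*_•` remove the fermions
  one by one (`transferProd_range_ket`). On states without fermions `T*_∘(x)` acts on the wedge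
  product attached to a partition as multiplication by the series `∑ x ^ k X ^ k`
  (`wedgeMap_monodromy`), so that the matrix element is a Jacobi–Trudi determinant
  (`prod_monodromy_apply_eq_det`), the skew Schur polynomial `s_{λ/μ}(x_1, …, x_ℓ)`.
* *Newton interpolation.* Let `A` be the product of `s_{λ/μ}` and the Vandermonde determinant. As
  `A` is antisymmetric, Newton interpolation in the variables `x_i⁻¹` writes `A`, up to a monomial
  factor, as the Vandermonde determinant at the inverses times an iterated divided difference
  (`aeval_eq_pairing`). Hence the base case is a divided difference too, and by the exchange
  relation all matrix elements are (`matrixElement_eq_pairing`): with the factors `T*_∘` at the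
  positions `k_j`, the divided difference in the `j`-th variable has order `k_j`.
* *Degrees.* A divided difference of order `k` of a power with exponent `k` is `1`, and with a
  smaller exponent it is `0`. As `|λ| = |μ| + |ν|`, the degree of `A` is such that for the positions
  in `κ` the divided difference is a single coefficient of `A` (`pairing_newtonFun_eq_coeff`), that
  of the leading monomial of the alternant of `ν`. This needs that each variable has degree at most
  `ℓ + L` in `A` (`apply_le_of_mem_support`).
* *Littlewood–Richardson.* That coefficient is the multiplicity of `s_ν` in `s_{λ/μ}`, which is the
  coefficient of `s_λ` in `s_μ s_ν` by Cauchy duality (`coeff_alt_mul_skew`, `lrCoeff_diagram`).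

If `μ` has a part larger than `L`, or `κ` contains a number that is not positive, both sides vanish.
-/

noncomputable section

/-! ### Elementary operators -/

namespace FermionBoson

variable {R : Type*} [CommRing R]

lemma end_ext {A B : Module.End R (Fock R)} (h : ∀ s, A (ket R s) = B (ket R s)) : A = B := by
  refine Finsupp.lhom_ext' fun s => LinearMap.ext_ring ?_
  exact h s

lemma bosonCreate_ket (i : ℕ) (s : Config) :
    bosonCreate R i (ket R s) = ket R (s.1, s.2 + Finsupp.single i 1) := ofKet_ket _ _

lemma bosonAnnihilate_ket (i : ℕ) (s : Config) :
    bosonAnnihilate R i (ket R s) =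
      if s.2 i = 0 then 0 else ket R (s.1, s.2 - Finsupp.single i 1) := ofKet_ket _ _

lemma fermionCreate_ket (i : ℕ) (s : Config) :
    fermionCreate R i (ket R s) = if i ∈ s.1 then 0 else ket R (insert i s.1, s.2) := ofKet_ket _ _

lemma fermionAnnihilate_ket (i : ℕ) (s : Config) :
    fermionAnnihilate R i (ket R s) = if i ∈ s.1 then ket R (s.1.erase i, s.2) else 0 :=
  ofKet_ket _ _

lemma fermionVacuum_ket (i : ℕ) (s : Config) :
    fermionVacuum R i (ket R s) = if i ∈ s.1 then 0 else ket R s := ofKet_ket _ _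

/-- `A` is one of the five elementary operators at site `i`. -/
def IsSiteOp (i : ℕ) (A : Module.End R (Fock R)) : Prop :=
  A = bosonCreate R i ∨ A = bosonAnnihilate R i ∨ A = fermionCreate R i ∨
    A = fermionAnnihilate R i ∨ A = fermionVacuum R i

lemma IsSiteOp.commute {i j : ℕ} (hij : i ≠ j) {A B : Module.End R (Fock R)}
    (hA : IsSiteOp i A) (hB : IsSiteOp j B) : A * B = B * A := by
  apply end_ext
  rintro ⟨a, m⟩
  have hji := hij.symm
  have e1 : (insert i (insert j a)) = insert j (insert i a) := Finset.insert_comm _ _ _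
  have e2 : (insert i (a.erase j)) = (insert i a).erase j :=
    (Finset.erase_insert_of_ne hij).symm
  have e3 : (insert j (a.erase i)) = (insert j a).erase i :=
    (Finset.erase_insert_of_ne hji).symm
  have e4 : (a.erase i).erase j = (a.erase j).erase i := Finset.erase_right_comm
  have e5 : m + Finsupp.single i 1 + Finsupp.single j 1 =
    m + Finsupp.single j 1 + Finsupp.single i 1 := add_right_comm _ _ _
  have e6 : m - Finsupp.single i 1 - Finsupp.single j 1 =
    m - Finsupp.single j 1 - Finsupp.single i 1 := tsub_right_comm
  have e7 : m j ≠ 0 → m + Finsupp.single i 1 - Finsupp.single j 1 =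
      m - Finsupp.single j 1 + Finsupp.single i 1 := fun h => by
    ext k
    by_cases h1 : k = i <;> by_cases h2 : k = j <;>
      simp_all [Finsupp.single_apply, eq_comm]
  have e8 : m i ≠ 0 → m + Finsupp.single j 1 - Finsupp.single i 1 =
      m - Finsupp.single i 1 + Finsupp.single j 1 := fun h => by
    ext k
    by_cases h1 : k = i <;> by_cases h2 : k = j <;>
      simp_all [Finsupp.single_apply, eq_comm]
  by_cases h1 : i ∈ a <;> by_cases h2 : j ∈ a <;> by_cases h3 : m i = 0 <;>
    by_cases h4 : m j = 0 <;>
  rcases hA with rfl | rfl | rfl | rfl | rfl <;> rcases hB with rfl | rfl | rfl | rfl | rfl <;>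
    simp [bosonCreate_ket, bosonAnnihilate_ket, fermionCreate_ket, fermionAnnihilate_ket,
      fermionVacuum_ket, *]

end FermionBoson

/-! ### The Yang–Baxter exchange relation -/

namespace FermionBoson

variable {R : Type*} [CommRing R]

/-- The weights with which two auxiliary lines labelled `k` and `l` cross without an exchange of
labels: the diagonal entries of the `R`-matrix, which solves the Yang–Baxter equation for `lMatrix`.
-/
def diagWeight (x y : R) : Fin 3 → Fin 3 → R :=
  ![![x, y, y], ![x, x, x], ![x, y, y]]

/-- Off-diagonal entries of the `R`-matrix: the two auxiliary lines exchange their labels. -/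
def swapWeight (x y : R) (k l : Fin 3) : R := if k < l then x - y else 0

/-- The Yang–Baxter exchange relation `R(x, y) (A ⊗ B) = (B ⊗ A) R(x, y)` between a matrix `A` with
spectral parameter `x` and a matrix `B` with spectral parameter `y`. -/
def Intertwined (x y : R) (A B : Matrix (Fin 3) (Fin 3) (Module.End R (Fock R))) : Prop :=
  ∀ k l a b, diagWeight x y k l • (A k a * B l b) + swapWeight x y k l • (A l a * B k b) =
    diagWeight x y a b • (B k a * A l b) + swapWeight x y b a • (B k b * A l a)

lemma intertwined_one (x y : R) : Intertwined x y 1 1 := by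
  intro k l a b
  fin_cases k <;> fin_cases l <;> fin_cases a <;> fin_cases b <;>
    simp [diagWeight, swapWeight]

/-- The exchange relation passes to products over sites, since operators at different sites
commute. -/
lemma Intertwined.mul {x y : R} {A A' B B' : Matrix (Fin 3) (Fin 3) (Module.End R (Fock R))}
    (h : Intertwined x y A B) (h' : Intertwined x y A' B')
    (hAB : ∀ k a l b, A' k a * B l b = B l b * A' k a)
    (hBA : ∀ k a l b, B' k a * A l b = A l b * B' k a) : Intertwined x y (A * A') (B * B') := by
  have swap : ∀ (C C' D D' : Matrix (Fin 3) (Fin 3) (Module.End R (Fock R)))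
      (_ : ∀ k a l b, C' k a * D l b = D l b * C' k a) (k l a b : Fin 3),
      (C * C') k a * (D * D') l b = ∑ c, ∑ e, C k c * D l e * (C' c a * D' e b) := by
    intro C C' D D' hc k l a b
    simp only [Matrix.mul_apply, Finset.sum_mul_sum]
    refine Finset.sum_congr rfl fun c _ => Finset.sum_congr rfl fun e _ => ?_
    rw [mul_assoc, ← mul_assoc (C' c a), hc, mul_assoc, mul_assoc]
  intro k l a b
  simp only [swap A A' B B' hAB, swap B B' A A' hBA, Finset.smul_sum, ← Finset.sum_add_distrib]
  have h1 : ∀ c e, diagWeight x y k l • (A k c * B l e * (A' c a * B' e b)) +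
      swapWeight x y k l • (A l c * B k e * (A' c a * B' e b)) =
      diagWeight x y c e • (B k c * A l e * (A' c a * B' e b)) +
        swapWeight x y e c • (B k e * A l c * (A' c a * B' e b)) := by
    intro c e
    have := congrArg (· * (A' c a * B' e b)) (h k l c e)
    simpa only [add_mul, smul_mul_assoc] using this
  have h2 : ∀ c e, diagWeight x y a b • (B k c * A l e * (B' c a * A' e b)) +
      swapWeight x y b a • (B k c * A l e * (B' c b * A' e a)) =
      diagWeight x y c e • (B k c * A l e * (A' c a * B' e b)) +
        swapWeight x y c e • (B k c * A l e * (A' e a * B' c b)) := by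
    intro c e
    have := congrArg (B k c * A l e * ·) (h' c e a b)
    simpa only [mul_add, mul_smul_comm] using this.symm
  simp only [h1, h2, Finset.sum_add_distrib]
  congr 1
  exact Finset.sum_comm

lemma lMatrix_ket_of_mem (x : R) {i : ℕ} {s : Finset ℕ} (hi : i ∈ s) (m : ℕ →₀ ℕ) :
    lMatrix x i 0 0 (ket R (s, m)) = ket R (s, m) ∧
    lMatrix x i 0 1 (ket R (s, m)) = x • ket R (s, m + Finsupp.single i 1) ∧
    lMatrix x i 0 2 (ket R (s, m)) = 0 ∧
    lMatrix x i 1 0 (ket R (s, m)) = 0 ∧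
    lMatrix x i 1 1 (ket R (s, m)) = 0 ∧
    lMatrix x i 1 2 (ket R (s, m)) = 0 ∧
    lMatrix x i 2 0 (ket R (s, m)) = ket R (s.erase i, m) ∧
    lMatrix x i 2 1 (ket R (s, m)) = x • ket R (s.erase i, m + Finsupp.single i 1) ∧
    lMatrix x i 2 2 (ket R (s, m)) = 0 := by
  refine ⟨?_, ?_, ?_, ?_, ?_, ?_, ?_, ?_, ?_⟩ <;>
    simp [lMatrix, bosonCreate_ket, bosonAnnihilate_ket, fermionCreate_ket,
      fermionAnnihilate_ket, fermionVacuum_ket, hi, apply_ite]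

lemma lMatrix_ket_of_notMem (x : R) {i : ℕ} {s : Finset ℕ} (hi : i ∉ s) (m : ℕ →₀ ℕ) :
    lMatrix x i 0 0 (ket R (s, m)) = ket R (s, m) ∧
    lMatrix x i 0 1 (ket R (s, m)) = x • ket R (s, m + Finsupp.single i 1) ∧
    lMatrix x i 0 2 (ket R (s, m)) = x • ket R (insert i s, m) ∧
    lMatrix x i 1 0 (ket R (s, m)) =
      (if m i = 0 then 0 else ket R (s, m - Finsupp.single i 1)) ∧
    lMatrix x i 1 1 (ket R (s, m)) = x • ket R (s, m) ∧
    lMatrix x i 1 2 (ket R (s, m)) = 0 ∧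
    lMatrix x i 2 0 (ket R (s, m)) = 0 ∧
    lMatrix x i 2 1 (ket R (s, m)) = 0 ∧
    lMatrix x i 2 2 (ket R (s, m)) = x • ket R (s, m) := by
  refine ⟨?_, ?_, ?_, ?_, ?_, ?_, ?_, ?_, ?_⟩ <;>
    simp [lMatrix, bosonCreate_ket, bosonAnnihilate_ket, fermionCreate_ket,
      fermionAnnihilate_ket, fermionVacuum_ket, hi, apply_ite (fermionVacuum R i)]

lemma fin_three_cases (k : Fin 3) : k = 0 ∨ k = 1 ∨ k = 2 := by
  revert k; decide

lemma diagWeight_apply {S : Type*} (x y : S) :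
    diagWeight x y 0 0 = x ∧ diagWeight x y 0 1 = y ∧ diagWeight x y 0 2 = y ∧
    diagWeight x y 1 0 = x ∧ diagWeight x y 1 1 = x ∧ diagWeight x y 1 2 = x ∧
    diagWeight x y 2 0 = x ∧ diagWeight x y 2 1 = y ∧ diagWeight x y 2 2 = y := by
  simp [diagWeight]

lemma swapWeight_apply (x y : R) :
    swapWeight x y 0 0 = 0 ∧ swapWeight x y 0 1 = x - y ∧ swapWeight x y 0 2 = x - y ∧
    swapWeight x y 1 0 = 0 ∧ swapWeight x y 1 1 = 0 ∧ swapWeight x y 1 2 = x - y ∧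
    swapWeight x y 2 0 = 0 ∧ swapWeight x y 2 1 = 0 ∧ swapWeight x y 2 2 = 0 := by
  simp [swapWeight]

set_option maxHeartbeats 2000000 in
/-- The `81` components of the exchange relation at one site are checked on basis vectors. -/
lemma intertwined_lMatrix (x y : R) (i : ℕ) : Intertwined x y (lMatrix x i) (lMatrix y i) := by
  intro k l a b
  apply end_ext
  rintro ⟨s, m⟩
  obtain ⟨d1, d2, d3, d4, d5, d6, d7, d8, d9⟩ := diagWeight_apply x y
  obtain ⟨o1, o2, o3, o4, o5, o6, o7, o8, o9⟩ := swapWeight_apply x y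
  have hins : i ∈ insert i s := Finset.mem_insert_self _ _
  have hera : i ∉ s.erase i := Finset.notMem_erase _ _
  have hz : ∀ m' : ℕ →₀ ℕ, (m' + Finsupp.single i 1 : ℕ →₀ ℕ) i ≠ 0 := by simp
  by_cases h1 : i ∈ s
  · have e1 := fun z m' => lMatrix_ket_of_mem (R := R) z h1 m'
    have e2 := fun z m' => lMatrix_ket_of_notMem (R := R) z hera m'
    have e3 : insert i (s.erase i) = s := Finset.insert_erase h1
    by_cases h2 : m i = 0 <;>
    rcases fin_three_cases k with rfl | rfl | rfl <;>
    rcases fin_three_cases l with rfl | rfl | rfl <;>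
    rcases fin_three_cases a with rfl | rfl | rfl <;>
    rcases fin_three_cases b with rfl | rfl | rfl <;>
    simp only [d1, d2, d3, d4, d5, d6, d7, d8, d9, o1, o2, o3, o4, o5, o6, o7, o8, o9,
      e1, e2, e3, h2, hz, LinearMap.add_apply, LinearMap.zero_apply, LinearMap.smul_apply,
      Module.End.mul_apply,
      map_smul, map_zero, smul_zero, zero_smul, ↓reduceIte, add_tsub_cancel_right] <;>
    module
  · have e1 := fun z m' => lMatrix_ket_of_notMem (R := R) z h1 m'
    have e2 := fun z m' => lMatrix_ket_of_mem (R := R) z hins m'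
    have e3 : (insert i s).erase i = s := Finset.erase_insert h1
    by_cases h2 : m i = 0
    · rcases fin_three_cases k with rfl | rfl | rfl <;>
      rcases fin_three_cases l with rfl | rfl | rfl <;>
      rcases fin_three_cases a with rfl | rfl | rfl <;>
      rcases fin_three_cases b with rfl | rfl | rfl <;>
      simp only [d1, d2, d3, d4, d5, d6, d7, d8, d9, o1, o2, o3, o4, o5, o6, o7, o8, o9,
        e1, e2, e3, hz, h2, LinearMap.add_apply, LinearMap.zero_apply, LinearMap.smul_apply,
        Module.End.mul_apply, map_smul, map_zero, smul_zero, zero_smul, ↓reduceIte,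
        add_tsub_cancel_right] <;>
      module
    · have e4 : m - Finsupp.single i 1 + Finsupp.single i 1 = m :=
        tsub_add_cancel_of_le (Finsupp.single_le_iff.2 (Nat.one_le_iff_ne_zero.2 h2))
      by_cases h3 : (m - Finsupp.single i 1 : ℕ →₀ ℕ) i = 0 <;>
      rcases fin_three_cases k with rfl | rfl | rfl <;>
      rcases fin_three_cases l with rfl | rfl | rfl <;>
      rcases fin_three_cases a with rfl | rfl | rfl <;>
      rcases fin_three_cases b with rfl | rfl | rfl <;>
      simp only [d1, d2, d3, d4, d5, d6, d7, d8, d9, o1, o2, o3, o4, o5, o6, o7, o8, o9,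
        e1, e2, e3, e4, hz, h2, h3, LinearMap.add_apply, LinearMap.zero_apply, LinearMap.smul_apply,
        Module.End.mul_apply, map_smul, map_zero, smul_zero, zero_smul, ↓reduceIte,
        add_tsub_cancel_right] <;>
      module

lemma commute_lMatrix {i j : ℕ} (hij : i ≠ j) (x y : R) (k a l b : Fin 3) :
    Commute (lMatrix x i k a) (lMatrix y j l b) := by
  have key : ∀ {i : ℕ} {z : R} {k a : Fin 3} {B : Module.End R (Fock R)},
      (∀ A, IsSiteOp i A → Commute A B) → Commute (lMatrix z i k a) B := by
    intro i z k a B h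
    have h1 := h _ (Or.inl rfl)
    have h2 := h _ (Or.inr (Or.inl rfl))
    have h3 := h _ (Or.inr (Or.inr (Or.inl rfl)))
    have h4 := h _ (Or.inr (Or.inr (Or.inr (Or.inl rfl))))
    have h5 := h _ (Or.inr (Or.inr (Or.inr (Or.inr rfl))))
    fin_cases k <;> fin_cases a
    exacts [Commute.one_left B, Commute.smul_left h1 z, Commute.smul_left h3 z, h5.mul_left h2,
      Commute.smul_left h5 z, Commute.zero_left B, h4, Commute.smul_left (h4.mul_left h1) z,
      Commute.smul_left h5 z]
  refine key fun A hA => (key fun B hB => ?_).symm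
  exact (IsSiteOp.commute hij hA hB).symm

lemma commute_lMatrix_monodromy {i n : ℕ} (hi : n ≤ i) (x y : R) (k a l b : Fin 3) :
    Commute (lMatrix x i k a) (monodromy y n l b) := by
  induction n generalizing b with
  | zero =>
    by_cases h : l = b
    · subst h; simp [monodromy]
    · simp [monodromy, Matrix.one_apply_ne h]
  | succ n ih =>
    rw [monodromy, Matrix.mul_apply]
    exact Commute.sum_right _ _ _ fun c _ =>
      (ih (by omega) c).mul_right (commute_lMatrix (by omega) _ _ _ _ _ _)

lemma intertwined_monodromy (x y : R) (n : ℕ) :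
    Intertwined x y (monodromy x n) (monodromy y n) := by
  induction n with
  | zero => exact intertwined_one x y
  | succ n ih =>
    exact ih.mul (intertwined_lMatrix x y n)
      (fun _ _ _ _ => commute_lMatrix_monodromy le_rfl _ _ _ _ _ _)
      (fun _ _ _ _ => commute_lMatrix_monodromy le_rfl _ _ _ _ _ _)

/-- Exchange of a `T*_∘` and a `T*_•`. In terms of the inverse spectral parameters this is a
divided difference. -/
lemma monodromy_exchange (x y : R) (n : ℕ) :
    (y - x) • (monodromy x n 2 0 * monodromy y n 0 0) =
      y • (monodromy x n 0 0 * monodromy y n 2 0) -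
        x • (monodromy y n 0 0 * monodromy x n 2 0) := by
  have h := intertwined_monodromy x y n 0 2 0 0
  obtain ⟨d1, -, d3, -⟩ := diagWeight_apply x y
  obtain ⟨o1, -, o3, -⟩ := swapWeight_apply x y
  rw [d3, o3, d1, o1, zero_smul, add_zero] at h
  rw [← h]
  module

end FermionBoson

/-! ### Sectors of given width and fermion number -/

namespace FermionBoson

variable {R : Type*} [CommRing R]

lemma width_le_iff {s : Config} {N : ℕ} :
    width s ≤ N ↔ (∀ i ∈ s.1, i < N) ∧ ∀ i, s.2 i ≠ 0 → i < N := by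
  simp [width]

variable (R) in
/-- The span of the configurations that live on the first `N` sites and have `c` fermions. -/
def sector (N : ℕ) (c : ℤ) : Submodule R (Fock R) :=
  Finsupp.supported R R {s : Config | width s ≤ N ∧ (s.1.card : ℤ) = c}

lemma ket_mem_sector {N : ℕ} {c : ℤ} {s : Config} (h : ∀ i ∈ s.1, i < N)
    (h' : ∀ i, s.2 i ≠ 0 → i < N) (hc : (s.1.card : ℤ) = c) : ket R s ∈ sector R N c :=
  Finsupp.single_mem_supported R 1 ⟨width_le_iff.2 ⟨h, h'⟩, hc⟩

lemma sector_induction {N : ℕ} {c : ℤ} {A : Module.End R (Fock R)} {P : Submodule R (Fock R)}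
    (h : ∀ s m, (∀ i ∈ s, i < N) → (∀ i, m i ≠ 0 → i < N) → (s.card : ℤ) = c →
      A (ket R (s, m)) ∈ P) {v : Fock R} (hv : v ∈ sector R N c) : A v ∈ P := by
  have : sector R N c ≤ P.comap A := by
    rw [sector, Finsupp.supported_eq_span_single, Submodule.span_le]
    rintro _ ⟨s, ⟨hs, hc⟩, rfl⟩
    rw [width_le_iff] at hs
    exact h s.1 s.2 hs.1 hs.2 hc
  exact this hv

lemma sector_ext {N : ℕ} {c : ℤ} {M : Type*} [AddCommGroup M] [Module R M] {A B : Fock R →ₗ[R] M}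
    (h : ∀ s m, (∀ i ∈ s, i < N) → (∀ i, m i ≠ 0 → i < N) → (s.card : ℤ) = c →
      A (ket R (s, m)) = B (ket R (s, m))) {v : Fock R} (hv : v ∈ sector R N c) : A v = B v := by
  have : sector R N c ≤ LinearMap.eqLocus A B := by
    rw [sector, Finsupp.supported_eq_span_single, Submodule.span_le]
    rintro _ ⟨s, ⟨hs, hc⟩, rfl⟩
    rw [width_le_iff] at hs
    exact h s.1 s.2 hs.1 hs.2 hc
  exact this hv

/-- The number of fermions carried by a horizontal edge. -/
def edgeCharge (k : Fin 3) : ℤ := if k = 2 then 1 else 0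

/-- Fermions are conserved at a vertex: the row operators change the fermion number by the charges
of the two outer horizontal edges. -/
lemma lMatrix_mem_sector {N i : ℕ} (hi : i < N) {c : ℤ} (x : R) (k a : Fin 3) {v : Fock R}
    (hv : v ∈ sector R N c) :
    lMatrix x i k a v ∈ sector R N (c + edgeCharge a - edgeCharge k) := by
  refine sector_induction (fun s m hs hm hc => ?_) hv
  have hm1 : ∀ j, (m + Finsupp.single i 1 : ℕ →₀ ℕ) j ≠ 0 → j < N := fun j hj => by
    by_cases hij : j = i
    · omega
    · exact hm j (by simpa [Finsupp.single_apply, Ne.symm hij] using hj)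
  have hm2 : ∀ j, (m - Finsupp.single i 1 : ℕ →₀ ℕ) j ≠ 0 → j < N := fun j hj =>
    hm j (by intro h; simp [h] at hj)
  have hs1 : ∀ j ∈ insert i s, j < N := by simpa [hi] using hs
  have hs2 : ∀ j ∈ s.erase i, j < N := fun j hj => hs j (Finset.mem_of_mem_erase hj)
  by_cases h : i ∈ s
  · obtain ⟨e1, e2, e3, e4, e5, e6, e7, e8, e9⟩ := lMatrix_ket_of_mem x h m
    have hc2 : ((s.erase i).card : ℤ) = c - 1 := by
      have := Finset.card_erase_add_one h
      omega
    rcases fin_three_cases k with rfl | rfl | rfl <;>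
    rcases fin_three_cases a with rfl | rfl | rfl <;>
    simp only [e1, e2, e3, e4, e5, e6, e7, e8, e9] <;>
    first
    | exact zero_mem _
    | exact ket_mem_sector ‹_› ‹_› (by simp only [hc2, hc]; simp [edgeCharge])
    | exact Submodule.smul_mem _ _
        (ket_mem_sector ‹_› ‹_› (by simp only [hc2, hc]; simp [edgeCharge]))
  · obtain ⟨e1, e2, e3, e4, e5, e6, e7, e8, e9⟩ := lMatrix_ket_of_notMem x h m
    have hc2 : ((insert i s).card : ℤ) = c + 1 := by
      have := Finset.card_insert_of_notMem h
      omega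
    rcases fin_three_cases k with rfl | rfl | rfl <;>
    rcases fin_three_cases a with rfl | rfl | rfl <;>
    simp only [e1, e2, e3, e4, e5, e6, e7, e8, e9] <;>
    try split_ifs
    all_goals first
    | exact zero_mem _
    | exact ket_mem_sector ‹_› ‹_› (by simp only [hc]; simp [edgeCharge])
    | exact Submodule.smul_mem _ _
        (ket_mem_sector ‹_› ‹_› (by simp only [hc2, hc]; simp [edgeCharge]))

lemma monodromy_mem_sector {N n : ℕ} (hn : n ≤ N) {c : ℤ} (x : R) (k a : Fin 3) {v : Fock R}
    (hv : v ∈ sector R N c) :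
    monodromy x n k a v ∈ sector R N (c + edgeCharge a - edgeCharge k) := by
  induction n generalizing a v c with
  | zero =>
    by_cases h : k = a
    · subst h; simpa [monodromy] using hv
    · simp [monodromy, Matrix.one_apply_ne h]
  | succ n ih =>
    rw [monodromy, Matrix.mul_apply, LinearMap.sum_apply]
    refine Submodule.sum_mem _ fun b _ => ?_
    have := ih (by omega) b (lMatrix_mem_sector (show n < N by omega) x b a hv)
    have e : c + edgeCharge a - edgeCharge b + edgeCharge b - edgeCharge k =
        c + edgeCharge a - edgeCharge k := by ring
    rw [e] at this
    exact this

/-- On the configurations on the first `N` sites the infinite product over sites may be cut off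
at `N`. -/
lemma rowOp_eq_monodromy {N : ℕ} {c : ℤ} (k : Fin 3) (x : R) {v : Fock R}
    (hv : v ∈ sector R N c) : rowOp k x v = monodromy x N k 0 v :=
  sector_ext (fun _ _ hs hm _ => (monodromy_apply_ket k x _ (width_le_iff.2 ⟨hs, hm⟩)).symm) hv

lemma monodromy_succ_apply (x : R) (n : ℕ) (k a : Fin 3) (v : Fock R) :
    monodromy x (n + 1) k a v = monodromy x n k 0 (lMatrix x n 0 a v) +
      monodromy x n k 1 (lMatrix x n 1 a v) + monodromy x n k 2 (lMatrix x n 2 a v) := by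
  simp [monodromy, Matrix.mul_apply, Fin.sum_univ_three]

/-- A red line that meets no fermion passes straight through and collects `x` at each site. -/
lemma monodromy_two_ket_of_empty (x : R) (n : ℕ) (s : Finset ℕ) (m : ℕ →₀ ℕ)
    (hs : ∀ i < n, i ∉ s) :
    monodromy x n 2 0 (ket R (s, m)) = 0 ∧ monodromy x n 2 1 (ket R (s, m)) = 0 ∧
      monodromy x n 2 2 (ket R (s, m)) = x ^ n • ket R (s, m) := by
  induction n generalizing s m with
  | zero => simp [monodromy]
  | succ n ih =>
    have hs' : ∀ i < n, i ∉ s := fun i hi => hs i (by omega)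
    have hins : ∀ i < n, i ∉ insert n s := fun i hi => by
      simp [hs' i hi, hi.ne]
    obtain ⟨e1, e2, e3, e4, e5, e6, e7, e8, e9⟩ := lMatrix_ket_of_notMem x (hs n (by omega)) m
    refine ⟨?_, ?_, ?_⟩
    · rw [monodromy_succ_apply, e1, e4, e7, (ih s m hs').1, apply_ite (monodromy x n 2 1),
        (ih s _ hs').2.1]
      simp
    · rw [monodromy_succ_apply, e2, e5, e8, map_smul, map_smul, (ih s _ hs').1, (ih s _ hs').2.1]
      simp
    · rw [monodromy_succ_apply, e3, e6, e9, map_smul, map_smul, (ih _ m hins).1, (ih s m hs').2.2]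
      simp [pow_succ', smul_smul]

/-- A red line entering from the left pulls out the first of a row of fermions. -/
lemma monodromy_two_ket_Ico (x : R) {j n N : ℕ} (hj : j < n) (hn : n ≤ N) (m : ℕ →₀ ℕ) :
    monodromy x n 2 0 (ket R (Finset.Ico j N, m)) = x ^ j • ket R (Finset.Ico (j + 1) N, m) := by
  induction n, hj using Nat.le_induction with
  | base =>
    obtain ⟨e1, -, -, e4, -, -, e7, -⟩ :=
      lMatrix_ket_of_mem x (i := j) (s := Finset.Ico j N) (by simp; omega) m
    have he : (Finset.Ico j N).erase j = Finset.Ico (j + 1) N := by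
      ext i; simp only [Finset.mem_erase, Finset.mem_Ico]; omega
    rw [monodromy_succ_apply, e1, e4, e7, he,
      (monodromy_two_ket_of_empty x j _ m (by intro i hi; simp only [Finset.mem_Ico]; omega)).1,
      (monodromy_two_ket_of_empty x j _ m (by intro i hi; simp only [Finset.mem_Ico]; omega)).2.2]
    simp
  | succ n hj ih =>
    obtain ⟨e1, -, -, e4, -, -, e7, -⟩ :=
      lMatrix_ket_of_mem x (i := n) (s := Finset.Ico j N) (by simp; omega) m
    -- The red line cannot pass the occupied site `n - 1`.
    have hblock : monodromy x n 2 2 (ket R ((Finset.Ico j N).erase n, m)) = 0 := by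
      obtain ⟨p, rfl⟩ : ∃ p, n = p + 1 := ⟨n - 1, by omega⟩
      obtain ⟨-, -, f3, -, -, f6, -, -, f9⟩ :=
        lMatrix_ket_of_mem x (i := p) (s := (Finset.Ico j N).erase (p + 1)) (by simp; omega) m
      rw [monodromy_succ_apply, f3, f6, f9]
      simp
    rw [monodromy_succ_apply, e1, e4, e7, hblock, ih (by omega)]
    simp

end FermionBoson

/-! ### Transfer matrices on wedge products -/

namespace FermionBoson

variable {R : Type*} [CommRing R] {𝒜 : Type*} [Ring 𝒜] [Algebra R 𝒜]

/-- `e p * e (p + 1) * ⋯` with `k` factors. -/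
def runProd (e : ℕ → 𝒜) : ℕ → ℕ → 𝒜
  | _, 0 => 1
  | p, k + 1 => e p * runProd e (p + 1) k

lemma runProd_succ (e : ℕ → 𝒜) (p k : ℕ) : runProd e p (k + 1) = runProd e p k * e (p + k) := by
  induction k generalizing p with
  | zero => simp [runProd]
  | succ k ih =>
    rw [runProd, ih, runProd, mul_assoc]
    congr 3
    omega

/-- The index of the next factor after the sites `< n` in the wedge product attached to `m`. -/
def wedgePos (m : ℕ →₀ ℕ) (n : ℕ) : ℕ := n + ∑ k ∈ Finset.range n, m k

/-- The product attached to the bosons on the sites `< n`, listed by increasing site: a boson at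
site `k` that is preceded by `c` others contributes the factor `e (k + c)`. For anticommuting `e`
this is the boson-fermion correspondence between partitions and strictly increasing sequences. -/
def wedge (e : ℕ → 𝒜) (m : ℕ →₀ ℕ) : ℕ → 𝒜
  | 0 => 1
  | n + 1 => wedge e m n * runProd e (wedgePos m n) (m n)

/-- The factors contributed by the `r` sites from `n` on, when the first index is `p`. -/
def wedgeTail (e : ℕ → 𝒜) (m : ℕ →₀ ℕ) : ℕ → ℕ → ℕ → 𝒜
  | _, _, 0 => 1
  | n, p, r + 1 => runProd e p (m n) * wedgeTail e m (n + 1) (p + m n + 1) r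

lemma wedgePos_succ (m : ℕ →₀ ℕ) (n : ℕ) : wedgePos m (n + 1) = wedgePos m n + m n + 1 := by
  simp [wedgePos, Finset.sum_range_succ]; ring

lemma wedge_mul_wedgeTail (e : ℕ → 𝒜) (m : ℕ →₀ ℕ) (n r : ℕ) :
    wedge e m n * wedgeTail e m n (wedgePos m n) r = wedge e m (n + r) := by
  induction r generalizing n with
  | zero => simp [wedgeTail]
  | succ r ih =>
    rw [wedgeTail, ← mul_assoc, ← wedge, ← wedgePos_succ, ih]
    congr 1; omega

lemma wedgePos_congr {m m' : ℕ →₀ ℕ} {n : ℕ} (h : ∀ k < n, m k = m' k) :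
    wedgePos m n = wedgePos m' n := by
  rw [wedgePos, wedgePos, Finset.sum_congr rfl fun k hk => h k (Finset.mem_range.1 hk)]

lemma wedge_congr (e : ℕ → 𝒜) {m m' : ℕ →₀ ℕ} {n : ℕ} (h : ∀ k < n, m k = m' k) :
    wedge e m n = wedge e m' n := by
  induction n with
  | zero => rfl
  | succ n ih =>
    have h' : ∀ k < n, m k = m' k := fun k hk => h k (by omega)
    rw [wedge, wedge, ih h', h n (by omega), wedgePos_congr h']

lemma wedgeTail_congr (e : ℕ → 𝒜) {m m' : ℕ →₀ ℕ} {n : ℕ} (h : ∀ k, n ≤ k → m k = m' k)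
    (p r : ℕ) : wedgeTail e m n p r = wedgeTail e m' n p r := by
  induction r generalizing n p with
  | zero => rfl
  | succ r ih =>
    rw [wedgeTail, wedgeTail, h n le_rfl, ih fun k hk => h k (by omega)]

variable (R) in
/-- The linear map sending a fermionless basis vector to its wedge product over the sites `< N`. -/
def wedgeMap (e : ℕ → 𝒜) (N : ℕ) : Fock R →ₗ[R] 𝒜 :=
  Finsupp.linearCombination R fun s : Config => if s.1 = ∅ then wedge e s.2 N else 0

lemma wedgeMap_ket (e : ℕ → 𝒜) (N : ℕ) (m : ℕ →₀ ℕ) :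
    wedgeMap R e N (ket R (∅, m)) = wedge e m N := by
  simp [wedgeMap, ket]

section Transfer

variable {x : R} {e E : ℕ → 𝒜}

/-- Since `E p` squares to zero, the recursion turns the factors `e` to the right of `E p`
into `E`. -/
lemma mul_runProd (hsucc : ∀ p, E (p + 1) = x • E p + e (p + 1)) (hsq : ∀ p, E p * E p = 0)
    (p k : ℕ) : E p * runProd e (p + 1) k = runProd E p (k + 1) := by
  induction k generalizing p with
  | zero => simp [runProd]
  | succ k ih =>
    have h : E p * e (p + 1) = E p * E (p + 1) := by
      rw [hsucc, mul_add, mul_smul_comm, hsq, smul_zero, zero_add]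
    rw [runProd, ← mul_assoc, h, mul_assoc, ih, ← runProd]

/-- The row transfer matrices act on wedge products by replacing each factor `e p` with
`E p = ∑_{k ≤ p} x ^ (p - k) e k`. The entry `(0, 1)` of the monodromy matrix creates one more
boson, which enters from the right. -/
lemma wedgeMap_monodromy_aux (h0 : E 0 = e 0) (hsucc : ∀ p, E (p + 1) = x • E p + e (p + 1))
    (hsq : ∀ p, E p * E p = 0) (n r : ℕ) (m : ℕ →₀ ℕ) :
    wedgeMap R e (n + r) (monodromy x n 0 0 (ket R (∅, m))) =
        wedge E m n * wedgeTail e m n (wedgePos m n) r ∧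
      wedgeMap R e (n + r) (monodromy x n 0 1 (ket R (∅, m))) =
        wedge E m n * (E (wedgePos m n) - e (wedgePos m n)) *
          wedgeTail e m n (wedgePos m n + 1) r := by
  induction n generalizing r m with
  | zero =>
    have := wedge_mul_wedgeTail e m 0 r
    simp only [zero_add] at this ⊢
    simp [monodromy, wedgeMap_ket, wedge, wedgePos, h0, ← this]
  | succ n ih =>
    obtain ⟨e1, e2, e3, e4, e5, e6, e7, e8, e9⟩ :=
      lMatrix_ket_of_notMem x (Finset.notMem_empty n) m
    have ih' := fun m => ih (r + 1) m
    simp only [← add_assoc, add_right_comm n r 1] at ih'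
    set p := wedgePos m n with hp
    have lowcongr : ∀ m' : ℕ →₀ ℕ, (∀ k, k ≠ n → m' k = m k) →
        wedge E m' n = wedge E m n ∧ wedgePos m' n = p ∧
          ∀ q, wedgeTail e m' (n + 1) q r = wedgeTail e m (n + 1) q r := fun m' h =>
      ⟨wedge_congr E fun k hk => h k (by omega), wedgePos_congr fun k hk => h k (by omega),
        fun q => wedgeTail_congr e (fun k hk => h k (by omega)) q r⟩
    constructor
    · rw [monodromy_succ_apply, e1, e4, e7, map_zero, add_zero, map_add, (ih' m).1, ← hp,
        wedgePos_succ, ← hp, wedge, ← hp, wedgeTail]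
      split_ifs with hn
      · simp [hn, runProd]
      · obtain ⟨k, hk⟩ := Nat.exists_eq_succ_of_ne_zero hn
        obtain ⟨c1, c2, c3⟩ := lowcongr (m - Finsupp.single n 1) fun j hj => by
          simp [hj.symm]
        have hk' : (m - Finsupp.single n 1 : ℕ →₀ ℕ) n = k := by simp [hk]
        rw [(ih' _).2, c1, c2, wedgeTail, hk', c3, hk, Nat.succ_eq_add_one,
          ← mul_runProd hsucc hsq, runProd,
          show p + 1 + k + 1 = p + (k + 1) + 1 by ring]
        noncomm_ring
    · obtain ⟨c1, c2, c3⟩ := lowcongr (m + Finsupp.single n 1) fun j hj => by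
          simp [hj.symm]
      have hk' : (m + Finsupp.single n 1 : ℕ →₀ ℕ) n = m n + 1 := by simp
      have hE : E (p + m n + 1) - e (p + m n + 1) = x • E (p + m n) := by
        rw [hsucc, add_sub_cancel_right]
      rw [monodromy_succ_apply, e2, e5, e8, map_zero, add_zero, map_add, map_smul, map_smul,
        map_smul, map_smul, (ih' m).2, (ih' _).1, c1, c2, wedgePos_succ, ← hp, wedge, ← hp,
        wedgeTail, wedgeTail, hk', c3, hE, mul_smul_comm, smul_mul_assoc, ← smul_add,
        mul_assoc (wedge E m n) (runProd E p (m n)),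
        ← runProd_succ, ← mul_runProd hsucc hsq, runProd,
        show p + 1 + m n + 1 = p + m n + 1 + 1 by ring,
        show p + (m n + 1) + 1 = p + m n + 1 + 1 by ring]
      congr 1
      noncomm_ring

/-- On states without fermions `T*_∘(x)` becomes the substitution `e ↦ E` in wedge products, a
multiplication by a geometric series when `e p` is the coefficient of `X ^ p` of a series. -/
lemma wedgeMap_monodromy (h0 : E 0 = e 0) (hsucc : ∀ p, E (p + 1) = x • E p + e (p + 1))
    (hsq : ∀ p, E p * E p = 0) {N : ℕ} {v : Fock R} (hv : v ∈ sector R N 0) :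
    wedgeMap R e N (monodromy x N 0 0 v) = wedgeMap R E N v := by
  refine sector_ext (A := (wedgeMap R e N).comp (monodromy x N 0 0)) (fun s m _ _ hs => ?_) hv
  obtain rfl : s = ∅ := by simpa using hs
  simpa [wedgeMap_ket, wedgeTail] using (wedgeMap_monodromy_aux h0 hsucc hsq N 0 m).1

end Transfer

/-- The bosons on the sites `< n`, listed by increasing site. -/
def bosonList (m : ℕ →₀ ℕ) : ℕ → List ℕ
  | 0 => []
  | n + 1 => bosonList m n ++ List.replicate (m n) n

lemma runProd_eq_prod (e : ℕ → 𝒜) (p k : ℕ) :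
    runProd e p k = (List.ofFn fun i : Fin k => e (p + i)).prod := by
  induction k generalizing p with
  | zero => simp [runProd]
  | succ k ih =>
    rw [runProd, ih, List.ofFn_succ, List.prod_cons]
    simp [add_assoc, add_comm 1]

lemma length_bosonList (m : ℕ →₀ ℕ) (n : ℕ) :
    (bosonList m n).length = ∑ k ∈ Finset.range n, m k := by
  induction n with
  | zero => rfl
  | succ n ih => simp [bosonList, ih, Finset.sum_range_succ]

lemma wedge_eq_prod (e : ℕ → 𝒜) (m : ℕ →₀ ℕ) (n : ℕ) :
    wedge e m n = ((bosonList m n).mapIdx fun i v => e (v + i)).prod := by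
  induction n with
  | zero => simp [wedge, bosonList]
  | succ n ih =>
    rw [wedge, bosonList, List.mapIdx_append, List.prod_append, ← ih, runProd_eq_prod]
    congr 2
    apply List.ext_getElem
    · simp
    · intro i h1 h2
      simp [wedgePos, length_bosonList, add_assoc, add_comm i]

lemma lt_of_mem_bosonList {m : ℕ →₀ ℕ} {n v : ℕ} (h : v ∈ bosonList m n) : v < n := by
  induction n with
  | zero => simp [bosonList] at h
  | succ n ih =>
    rw [bosonList, List.mem_append, List.mem_replicate] at h
    rcases h with h | h
    · exact (ih h).trans n.lt_succ_self
    · omega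

lemma pairwise_bosonList (m : ℕ →₀ ℕ) (n : ℕ) : (bosonList m n).Pairwise (· ≤ ·) := by
  induction n with
  | zero => simp [bosonList]
  | succ n ih =>
    rw [bosonList, List.pairwise_append]
    refine ⟨ih, List.pairwise_replicate.2 (Or.inr le_rfl), fun a ha b hb => ?_⟩
    rw [List.eq_of_mem_replicate hb]
    exact (lt_of_mem_bosonList ha).le

lemma count_bosonList (m : ℕ →₀ ℕ) (n v : ℕ) :
    (bosonList m n).count v = if v < n then m v else 0 := by
  induction n with
  | zero => simp [bosonList]
  | succ n ih =>
    rw [bosonList, List.count_append, ih, List.count_replicate]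
    rcases lt_trichotomy v n with h | rfl | h
    · simp [h, h.ne', h.trans n.lt_succ_self]
    · simp
    · simp [h.not_gt, h.ne, show ¬ v < n + 1 by omega]

lemma bosonState_apply {ℓ : ℕ} (lam : Fin ℓ → ℕ) (v : ℕ) :
    bosonState lam v = (Finset.univ.filter fun i => lam i = v).card := by
  simp [bosonState, Finsupp.finsetSum_apply, Finsupp.single_apply, Finset.sum_boole]

lemma lt_of_bosonState_ne_zero {ℓ N : ℕ} {lam : Fin ℓ → ℕ} (h : ∀ i, lam i < N) {i : ℕ}
    (hi : bosonState lam i ≠ 0) : i < N := by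
  rw [bosonState_apply, Finset.card_ne_zero] at hi
  obtain ⟨j, hj⟩ := hi
  simpa [(Finset.mem_filter.1 hj).2] using h j

lemma bosonList_bosonState {ℓ : ℕ} {lam : Fin ℓ → ℕ} (h : Antitone lam) {N : ℕ}
    (hN : ∀ i, lam i < N) :
    bosonList (bosonState lam) N = List.ofFn fun i : Fin ℓ => lam i.rev := by
  refine List.Perm.eq_of_pairwise (le := (· ≤ ·)) (fun a b _ _ => le_antisymm)
    (pairwise_bosonList _ _) ?_ ?_
  · rw [List.pairwise_ofFn]
    intro i j hij
    exact h (Fin.rev_le_rev.2 hij.le)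
  · rw [List.perm_iff_count]
    intro v
    have e : (List.ofFn fun i : Fin ℓ => lam i.rev).count v =
        (Finset.univ.filter fun i => lam i = v).card := by
      have h1 : ((List.ofFn fun i : Fin ℓ => lam i.rev : List ℕ) : Multiset ℕ) =
          Finset.univ.val.map fun i : Fin ℓ => lam i.rev := by
        simp [List.ofFn_eq_map, Fin.univ_def]
      rw [← Multiset.coe_count, h1, Multiset.count_map, ← Finset.filter_val, Finset.card_val]
      refine Finset.card_bij (fun i _ => i.rev) ?_ ?_ ?_
      · intro i hi; simpa [eq_comm] using hi
      · intro i _ j _ hij; exact Fin.rev_injective hij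
      · intro i hi; exact ⟨i.rev, by simpa [eq_comm] using hi, by simp⟩
    rw [count_bosonList, e, bosonState_apply]
    split_ifs with hv
    · rfl
    · symm
      rw [Finset.card_eq_zero, Finset.filter_eq_empty_iff]
      intro i _ hi
      exact hv (hi ▸ hN i)

end FermionBoson

/-! ### Jacobi–Trudi determinants from states without fermions -/

namespace FermionBoson

open PowerSeries (coeff X)

variable {R : Type*} [CommRing R]

/-- The geometric series `∑ x ^ k X ^ k`. -/
def geo (x : R) : PowerSeries R := PowerSeries.mk fun k => x ^ k

lemma coeff_zero_mul_geo (x : R) (f : PowerSeries R) : coeff 0 (f * geo x) = coeff 0 f := by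
  simp [geo, PowerSeries.coeff_mul]

lemma geo_eq (x : R) : geo x = 1 + PowerSeries.C x * X * geo x := by
  ext (_ | n)
  · simp [geo]
  · rw [map_add, mul_assoc, PowerSeries.coeff_C_mul, PowerSeries.coeff_succ_X_mul]
    simp [geo, PowerSeries.coeff_one, pow_succ']

lemma coeff_succ_mul_geo (x : R) (f : PowerSeries R) (p : ℕ) :
    coeff (p + 1) (f * geo x) = x * coeff p (f * geo x) + coeff (p + 1) f := by
  conv_lhs => rw [geo_eq]
  rw [show f * (1 + PowerSeries.C x * X * geo x) = f + PowerSeries.C x * (X * (f * geo x)) by ring,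
    map_add, PowerSeries.coeff_C_mul, PowerSeries.coeff_succ_X_mul, add_comm]

/-- The strictly increasing sequence `λ_ℓ, λ_{ℓ-1} + 1, …, λ_1 + ℓ - 1`. -/
def betaSeq {ℓ : ℕ} (lam : Fin ℓ → ℕ) (i : Fin ℓ) : ℕ := lam i.rev + i

lemma betaSeq_strictMono {ℓ : ℕ} {lam : Fin ℓ → ℕ} (h : Antitone lam) :
    StrictMono (betaSeq lam) := fun _ _ hij =>
  add_lt_add_of_le_of_lt (h (Fin.rev_le_rev.2 hij.le)) hij

/-- The determinant of the first `ℓ` vectors of a wedge product in `⋀ (R ^ ℓ)`, zero in the degrees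
other than `ℓ`. -/
def topDet (R : Type*) [CommRing R] (ℓ : ℕ) : ExteriorAlgebra R (Fin ℓ → R) →ₗ[R] R :=
  ExteriorAlgebra.liftAlternating fun i =>
    if h : i = ℓ then (Matrix.detRowAlternating).domDomCongr (finCongr h.symm) else 0

lemma prod_map_ι_eq_ιMulti {M : Type*} [AddCommGroup M] [Module R M] (l : List M) :
    (l.map (ExteriorAlgebra.ι R)).prod = ExteriorAlgebra.ιMulti R l.length (fun i => l[i]) := by
  rw [ExteriorAlgebra.ιMulti_apply]
  congr 1
  apply List.ext_getElem <;> simp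

lemma topDet_prod {ℓ : ℕ} {l : List (Fin ℓ → R)} (h : l.length = ℓ) :
    topDet R ℓ (l.map (ExteriorAlgebra.ι R)).prod =
      (Matrix.of fun i : Fin ℓ => l[i]).det := by
  rw [prod_map_ι_eq_ιMulti, topDet, ExteriorAlgebra.liftAlternating_apply_ιMulti, dif_pos h]
  rfl

lemma topDet_prod_of_ne {ℓ : ℕ} {l : List (Fin ℓ → R)} (h : l.length ≠ ℓ) :
    topDet R ℓ (l.map (ExteriorAlgebra.ι R)).prod = 0 := by
  rw [prod_map_ι_eq_ιMulti, topDet, ExteriorAlgebra.liftAlternating_apply_ιMulti, dif_neg h]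
  rfl

/-- The row vector of the coefficients of `X ^ p` in the series `X ^ (q j) * f`. -/
def rowVec {ℓ : ℕ} (q : Fin ℓ → ℕ) (f : PowerSeries R) (p : ℕ) : Fin ℓ → R :=
  fun j => coeff p (X ^ q j * f)

lemma wedge_rowVec {ℓ : ℕ} (q : Fin ℓ → ℕ) (f : PowerSeries R) (m : ℕ →₀ ℕ) (N : ℕ) :
    wedge (fun p => ExteriorAlgebra.ι R (rowVec q f p)) m N =
      (((bosonList m N).mapIdx fun i v => rowVec q f (v + i)).map (ExteriorAlgebra.ι R)).prod := by
  rw [wedge_eq_prod]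
  congr 1
  apply List.ext_getElem <;> simp

lemma topDet_wedge_bosonState {ℓ N : ℕ} (q : Fin ℓ → ℕ) (f : PowerSeries R) {lam : Fin ℓ → ℕ}
    (h : Antitone lam) (hN : ∀ i, lam i < N) :
    topDet R ℓ (wedge (fun p => ExteriorAlgebra.ι R (rowVec q f p)) (bosonState lam) N) =
      (Matrix.of fun i j => coeff (betaSeq lam i) (X ^ q j * f)).det := by
  rw [wedge_rowVec, bosonList_bosonState h hN, topDet_prod (by simp)]
  congr 1
  ext i j
  simp [rowVec, betaSeq]

lemma bosonList_injective {m m' : ℕ →₀ ℕ} {N : ℕ} (hm : ∀ i, m i ≠ 0 → i < N)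
    (hm' : ∀ i, m' i ≠ 0 → i < N) (h : bosonList m N = bosonList m' N) : m = m' := by
  ext v
  have h1 := count_bosonList m N v
  rw [h, count_bosonList] at h1
  split_ifs at h1 with hv
  · exact h1.symm
  · rw [not_imp_comm.1 (hm v) hv, not_imp_comm.1 (hm' v) hv]

/-- Pairing with `⟨μ|` is a determinant: in the top exterior power, the wedge products of the basis
vectors with indices `betaSeq mu` (and `0` at the other indices) detect `|μ⟩`. -/
lemma topDet_wedgeMap_one {ℓ N : ℕ} {mu : Fin ℓ → ℕ} (h : Antitone mu) (hN : ∀ i, mu i < N)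
    {v : Fock R} (hv : v ∈ sector R N 0) :
    topDet R ℓ (wedgeMap R (fun p => ExteriorAlgebra.ι R (rowVec (betaSeq mu) 1 p)) N v) =
      v (∅, bosonState mu) := by
  refine sector_ext (A := (topDet R ℓ).comp (wedgeMap R _ N))
    (B := Finsupp.lapply ((∅, bosonState mu) : Config)) (fun s m _ hm hs => ?_) hv
  obtain rfl : s = ∅ := by simpa using hs
  have hmu : ∀ i, bosonState mu i ≠ 0 → i < N := fun i hi => lt_of_bosonState_ne_zero hN hi
  rw [LinearMap.comp_apply, wedgeMap_ket, Finsupp.lapply_apply]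
  by_cases hmm : m = bosonState mu
  · subst hmm
    rw [topDet_wedge_bosonState _ _ h hN]
    have : (Matrix.of fun i j => coeff (betaSeq mu i) (X ^ betaSeq mu j * (1 : PowerSeries R))) =
        1 := by
      ext i j
      simp [PowerSeries.coeff_X_pow, Matrix.one_apply, (betaSeq_strictMono h).injective.eq_iff]
    rw [this, Matrix.det_one]
    simp [ket]
  · have h0 : (ket R (∅, m)) (∅, bosonState mu) = 0 := by
      rw [ket, Finsupp.single_apply, if_neg]
      simpa using hmm
    rw [h0, wedge_rowVec]
    by_cases hl : (bosonList m N).length = ℓ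
    · rw [topDet_prod (by simpa using hl)]
      -- Both index sequences increase strictly, so that one of the rows vanishes.
      set p : Fin ℓ → ℕ := fun i => (bosonList m N)[i] + i with hp
      have hpm : StrictMono p := fun i j hij => by
        have := List.pairwise_iff_getElem.1 (pairwise_bosonList m N) i j (by omega) (by omega) hij
        exact add_lt_add_of_le_of_lt this hij
      by_cases hr : ∀ i, p i ∈ Set.range (betaSeq mu)
      · exfalso
        have hsub : Finset.univ.image p = Finset.univ.image (betaSeq mu) := by
          refine Finset.eq_of_subset_of_card_le (fun a ha => ?_) ?_
          · obtain ⟨i, -, rfl⟩ := Finset.mem_image.1 ha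
            simpa using hr i
          · rw [Finset.card_image_of_injective _ hpm.injective,
              Finset.card_image_of_injective _ (betaSeq_strictMono h).injective]
        have hrange : Set.range p = Set.range (betaSeq mu) := by
          simpa using congrArg (fun s : Finset ℕ => (s : Set ℕ)) hsub
        have hpq : p = betaSeq mu := (hpm.range_inj (betaSeq_strictMono h)).1 hrange
        refine hmm (bosonList_injective hm hmu ?_)
        rw [bosonList_bosonState h hN]
        apply List.ext_getElem (by simpa using hl)
        intro i h1 h2
        have := congrFun hpq ⟨i, by omega⟩
        simpa [hp, betaSeq] using this
      · push Not at hr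
        obtain ⟨i, hi⟩ := hr
        refine Matrix.det_eq_zero_of_row_eq_zero i fun j => ?_
        have : p i ≠ betaSeq mu j := fun e => hi ⟨j, e.symm⟩
        simp only [List.getElem_mapIdx, Matrix.of_apply, Fin.getElem_fin, rowVec, mul_one,
          PowerSeries.coeff_X_pow]
        exact if_neg this
    · exact topDet_prod_of_ne (by simpa using hl)

lemma prod_monodromy_mem_sector {N : ℕ} {c : ℤ} (xs : List R) {v : Fock R}
    (hv : v ∈ sector R N c) : (xs.map fun x => monodromy x N 0 0).prod v ∈ sector R N c := by
  induction xs with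
  | nil => simpa using hv
  | cons x xs ih => simpa using monodromy_mem_sector le_rfl x 0 0 ih

/-- In the absence of fermions the bosonic transfer matrices give the Jacobi–Trudi determinant of a
skew Schur function. -/
lemma prod_monodromy_apply_eq_det {ℓ N : ℕ} {lam mu : Fin ℓ → ℕ} (hlam : Antitone lam)
    (hmu : Antitone mu) (hlamN : ∀ i, lam i < N) (hmuN : ∀ i, mu i < N) (xs : List R) :
    (xs.map fun x => monodromy x N 0 0).prod (ket R (∅, bosonState lam)) (∅, bosonState mu) =
      (Matrix.of fun i j =>
        coeff (betaSeq lam i) (X ^ betaSeq mu j * (xs.map geo).prod)).det := by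
  have hket : ket R (∅, bosonState lam) ∈ sector R N 0 :=
    ket_mem_sector (by simp) (fun i hi => lt_of_bosonState_ne_zero hlamN hi) (by simp)
  have key : ∀ (f : PowerSeries R) (xs : List R),
      wedgeMap R (fun p => ExteriorAlgebra.ι R (rowVec (betaSeq mu) f p)) N
        ((xs.map fun x => monodromy x N 0 0).prod (ket R (∅, bosonState lam))) =
      wedgeMap R (fun p => ExteriorAlgebra.ι R (rowVec (betaSeq mu) (f * (xs.map geo).prod) p)) N
        (ket R (∅, bosonState lam)) := by
    intro f xs
    induction xs generalizing f with
    | nil => simp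
    | cons x xs ih =>
      rw [List.map_cons, List.prod_cons, Module.End.mul_apply, List.map_cons, List.prod_cons,
        ← mul_assoc, ← ih]
      refine wedgeMap_monodromy (x := x) ?_ (fun p => ?_) (fun p => by simp)
        (prod_monodromy_mem_sector xs hket)
      · congr 1
        ext j
        rw [rowVec, rowVec, ← mul_assoc, coeff_zero_mul_geo]
      · rw [← map_smul, ← map_add]
        congr 1
        ext j
        simp only [rowVec, Pi.add_apply, Pi.smul_apply, smul_eq_mul, ← mul_assoc]
        rw [coeff_succ_mul_geo]
  rw [← topDet_wedgeMap_one hmu hmuN (prod_monodromy_mem_sector xs hket), key, one_mul,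
    wedgeMap_ket, topDet_wedge_bosonState _ _ hlam hlamN]

end FermionBoson

/-! ### Newton interpolation and the Jacobi–Trudi identity -/

namespace FermionBoson

open PowerSeries (coeff X C)

variable {R : Type*} [CommRing R]

lemma geo_mul (x : R) : geo x * (1 - C x * X) = 1 := by
  have := geo_eq x
  linear_combination this

lemma geo_sub_geo (a b : R) : geo a - geo b = C (a - b) * (X * (geo a * geo b)) := by
  have ha := geo_mul a
  have hb := geo_mul b
  rw [map_sub]
  linear_combination (-geo a) * hb + geo b * ha

lemma coeff_geo (x : R) (n : ℕ) : coeff n (geo x) = x ^ n := by simp [geo]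

/-- The generating function, over the exponent `b`, of the divided differences of `u ^ b` at
`x 0, …, x k`. -/
def newton (x : ℕ → R) (k : ℕ) : PowerSeries R :=
  X ^ k * ∏ i ∈ Finset.range (k + 1), geo (x i)

lemma coeff_newton_of_lt (x : ℕ → R) {k b : ℕ} (h : b < k) : coeff b (newton x k) = 0 := by
  rw [newton, PowerSeries.coeff_X_pow_mul', if_neg (by omega)]

lemma constantCoeff_geo (x : R) : PowerSeries.constantCoeff (geo x) = 1 := by
  rw [← PowerSeries.coeff_zero_eq_constantCoeff_apply, coeff_geo, pow_zero]

lemma coeff_newton_self (x : ℕ → R) (k : ℕ) : coeff k (newton x k) = 1 := by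
  rw [newton, PowerSeries.coeff_X_pow_mul', if_pos le_rfl, Nat.sub_self,
    PowerSeries.coeff_zero_eq_constantCoeff_apply, map_prod]
  simp [constantCoeff_geo]

/-- The Newton basis polynomial of degree `k`, evaluated at `x j`. -/
def newtonBasis (x : ℕ → R) (k j : ℕ) : R := ∏ m ∈ Finset.range k, (x j - x m)

lemma newtonBasis_eq_zero (x : ℕ → R) {k j : ℕ} (h : j < k) : newtonBasis x k j = 0 :=
  Finset.prod_eq_zero (Finset.mem_range.2 h) (sub_self _)

lemma geo_eq_sum_newton_aux (x : ℕ → R) (j r : ℕ) :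
    geo (x j) = ∑ k ∈ Finset.range r, C (newtonBasis x k j) * newton x k +
      C (newtonBasis x r j) * (X ^ r * ((∏ i ∈ Finset.range r, geo (x i)) * geo (x j))) := by
  induction r with
  | zero => simp [newtonBasis]
  | succ r ih =>
    have h := geo_sub_geo (x j) (x r)
    have hN : newtonBasis x (r + 1) j = newtonBasis x r j * (x j - x r) := by
      rw [newtonBasis, Finset.prod_range_succ, newtonBasis]
    conv_lhs => rw [ih]
    rw [Finset.sum_range_succ, add_assoc, add_right_inj, hN, map_mul, newton,
      Finset.prod_range_succ, pow_succ]
    linear_combination (C (newtonBasis x r j) * X ^ r * ∏ i ∈ Finset.range r, geo (x i)) * h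

/-- Newton interpolation. -/
lemma geo_eq_sum_newton (x : ℕ → R) {j ℓ : ℕ} (h : j < ℓ) :
    geo (x j) = ∑ k : Fin ℓ, C (newtonBasis x k j) * newton x k := by
  have h1 : ∑ k : Fin ℓ, C (newtonBasis x k j) * newton x k =
      ∑ k ∈ Finset.range (j + 1), C (newtonBasis x k j) * newton x k := by
    rw [Fin.sum_univ_eq_sum_range (fun k => C (newtonBasis x k j) * newton x k)]
    symm
    refine Finset.sum_subset (by simpa using h) fun k _ hk => ?_
    rw [newtonBasis_eq_zero x (by simpa using hk), map_zero, zero_mul]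
  rw [h1, Finset.sum_range_succ, newton, Finset.prod_range_succ]
  exact geo_eq_sum_newton_aux x j j

lemma det_newtonBasis (x : ℕ → R) (ℓ : ℕ) :
    (Matrix.of fun k j : Fin ℓ => newtonBasis x k j).det =
      (Matrix.of fun k j : Fin ℓ => x j ^ (k : ℕ)).det := by
  rw [Matrix.det_of_isUpperTriangular, ← Matrix.det_transpose]
  · change _ = (Matrix.vandermonde fun j : Fin ℓ => x j).det
    rw [Matrix.det_vandermonde, Finset.prod_comm' (t' := Finset.univ) (s' := fun j => Finset.Iio j)
      (by simp)]
    refine Finset.prod_congr rfl fun j _ => ?_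
    simp only [Matrix.of_apply, newtonBasis]
    symm
    refine Finset.prod_bij (fun (i : Fin ℓ) _ => (i : ℕ)) ?_ ?_ ?_ ?_
    · intro i hi; simpa using hi
    · intro i _ i' _ h; exact Fin.ext h
    · intro b hb
      exact ⟨⟨b, (Finset.mem_range.1 hb).trans j.2⟩, Finset.mem_Iio.2 (Finset.mem_range.1 hb), rfl⟩
    · intro i _; rfl
  · intro i j hij
    exact newtonBasis_eq_zero x hij

/-- Multiplying out `X ^ k * ∏_{k < i < ℓ} (1 - x i X)` writes the Newton series as combinations of
the series `X ^ d * ∏_{i < ℓ} geo (x i)`, with a unitriangular matrix of coefficients. -/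
lemma newton_eq_sum (x : ℕ → R) {k ℓ : ℕ} (hk : k < ℓ) : ∃ c : ℕ → R, c k = 1 ∧
    (∀ d < k, c d = 0) ∧ newton x k =
      ∑ d : Fin ℓ, C (c d) * (X ^ (d : ℕ) * ∏ i ∈ Finset.range ℓ, geo (x i)) := by
  set P : Polynomial R := Polynomial.X ^ k *
    ∏ i ∈ Finset.Ico (k + 1) ℓ, (1 - Polynomial.C (x i) * Polynomial.X) with hP
  have hdeg : P.natDegree < ℓ := by
    have h1 : (∏ i ∈ Finset.Ico (k + 1) ℓ,
        (1 - Polynomial.C (x i) * Polynomial.X)).natDegree ≤ ℓ - (k + 1) := by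
      refine (Polynomial.natDegree_prod_le _ _).trans ?_
      refine (Finset.sum_le_card_nsmul _ _ 1 fun i _ => ?_).trans (by simp)
      refine (Polynomial.natDegree_sub_le _ _).trans ?_
      refine max_le (by simp) ((Polynomial.natDegree_C_mul_le _ _).trans Polynomial.natDegree_X_le)
    have h2 := Polynomial.natDegree_mul_le (p := (Polynomial.X ^ k : Polynomial R))
      (q := ∏ i ∈ Finset.Ico (k + 1) ℓ, (1 - Polynomial.C (x i) * Polynomial.X))
    have h3 := Polynomial.natDegree_X_pow_le (R := R) k
    rw [← hP] at h2
    omega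
  refine ⟨P.coeff, ?_, fun d hd => ?_, ?_⟩
  · rw [hP, Polynomial.coeff_X_pow_mul', if_pos le_rfl, Nat.sub_self,
      Polynomial.coeff_zero_eq_eval_zero, Polynomial.eval_prod]
    simp
  · rw [hP, Polynomial.coeff_X_pow_mul', if_neg (by omega)]
  · have h1 : (P : PowerSeries R) * ∏ i ∈ Finset.range ℓ, geo (x i) = newton x k := by
      rw [← Finset.prod_range_mul_prod_Ico _ (Nat.succ_le_of_lt hk), newton, hP,
        Polynomial.coe_mul, Polynomial.coe_pow, Polynomial.coe_X,
        ← Polynomial.coeToPowerSeries.ringHom_apply, map_prod]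
      have h2 : (∏ i ∈ Finset.Ico (k + 1) ℓ, (Polynomial.coeToPowerSeries.ringHom
            (1 - Polynomial.C (x i) * Polynomial.X))) *
          ∏ i ∈ Finset.Ico (k + 1) ℓ, geo (x i) = 1 := by
        rw [← Finset.prod_mul_distrib]
        refine Finset.prod_eq_one fun i _ => ?_
        rw [mul_comm]
        simpa using geo_mul (x i)
      linear_combination (X ^ k * ∏ i ∈ Finset.range (k + 1), geo (x i)) * h2
    rw [← h1]
    simp only [← mul_assoc]
    rw [← Finset.sum_mul]
    congr 1
    rw [Fin.sum_univ_eq_sum_range (fun d => C (P.coeff d) * X ^ d)]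
    conv_lhs => rw [P.as_sum_range_C_mul_X_pow' hdeg]
    rw [← Polynomial.coeToPowerSeries.ringHom_apply, map_sum]
    simp

/-- The Jacobi–Trudi identity, for an arbitrary sequence of exponents. -/
lemma det_coeff_mul_vandermonde (x : ℕ → R) {ℓ : ℕ} (γ : Fin ℓ → ℕ) :
    (Matrix.of fun i j : Fin ℓ =>
        coeff (γ i) (X ^ (j : ℕ) * ∏ k ∈ Finset.range ℓ, geo (x k))).det *
      (Matrix.of fun i j : Fin ℓ => x j ^ (i : ℕ)).det =
    (Matrix.of fun i j : Fin ℓ => x j ^ γ i).det := by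
  choose c hc1 hc0 hc using fun k : Fin ℓ => newton_eq_sum x k.2
  have hdet : (Matrix.of fun d k : Fin ℓ => c k d).det = 1 := by
    rw [Matrix.det_of_isLowerTriangular]
    · simp [hc1]
    · intro i j hij
      exact hc0 j i hij
  rw [← det_newtonBasis, ← mul_one (Matrix.det _), ← hdet, ← Matrix.det_mul, ← Matrix.det_mul]
  congr 1
  ext i j
  simp only [Matrix.mul_apply, Matrix.of_apply]
  rw [← coeff_geo, geo_eq_sum_newton x j.2, map_sum]
  refine Finset.sum_congr rfl fun k _ => ?_
  rw [PowerSeries.coeff_C_mul, hc k, map_sum, mul_comm]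
  congr 1
  refine Finset.sum_congr rfl fun d _ => ?_
  rw [PowerSeries.coeff_C_mul, mul_comm]

end FermionBoson

/-! ### Alternants, skew Schur polynomials and Cauchy duality -/

namespace FermionBoson

open MvPolynomial

/-- The exponent vector with the given entries. -/
abbrev expo {ℓ : ℕ} (d : Fin ℓ → ℕ) : Fin ℓ →₀ ℕ := Finsupp.equivFunOnFinite.symm d

/-- The variables `X 0, …, X (ℓ - 1)`, continued by zero. -/
def varSeq (ℓ : ℕ) (i : ℕ) : MvPolynomial (Fin ℓ) ℤ := if h : i < ℓ then X ⟨i, h⟩ else 0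

lemma varSeq_coe {ℓ : ℕ} (i : Fin ℓ) : varSeq ℓ i = X i := by simp [varSeq]

/-- The generating series of the complete homogeneous symmetric polynomials in `ℓ` variables. -/
def completeSeries (ℓ : ℕ) : PowerSeries (MvPolynomial (Fin ℓ) ℤ) :=
  ∏ k ∈ Finset.range ℓ, geo (varSeq ℓ k)

lemma completeSeries_eq_prod (ℓ : ℕ) : completeSeries ℓ = ∏ k : Fin ℓ, geo (X k) := by
  rw [completeSeries, ← Fin.prod_univ_eq_prod_range (fun k => geo (varSeq ℓ k))]
  simp only [varSeq_coe]

/-- The alternant `det (x_j ^ (γ i))`. -/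
def alt {ℓ : ℕ} (γ : Fin ℓ → ℕ) : MvPolynomial (Fin ℓ) ℤ :=
  (Matrix.of fun i j : Fin ℓ => (X j : MvPolynomial (Fin ℓ) ℤ) ^ γ i).det

/-- The Jacobi–Trudi determinant of the skew Schur polynomial with the shifted exponents `l` of the
outer and `q` of the inner partition. -/
def skew {ℓ : ℕ} (q l : Fin ℓ → ℕ) : MvPolynomial (Fin ℓ) ℤ :=
  (Matrix.of fun i j : Fin ℓ =>
    PowerSeries.coeff (l i) (PowerSeries.X ^ q j * completeSeries ℓ)).det

lemma skew_mul_alt {ℓ : ℕ} (γ : Fin ℓ → ℕ) :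
    skew (fun j => (j : ℕ)) γ * alt (fun j => (j : ℕ)) = alt γ := by
  have := det_coeff_mul_vandermonde (varSeq ℓ) γ
  simp only [varSeq_coe] at this
  exact this

lemma alt_eq_sum {ℓ : ℕ} (γ : Fin ℓ → ℕ) :
    alt γ = ∑ σ : Equiv.Perm (Fin ℓ), Equiv.Perm.sign σ • monomial (expo (γ ∘ σ)) 1 := by
  rw [alt, Matrix.det_apply]
  refine Finset.sum_congr rfl fun σ _ => ?_
  congr 1
  rw [monomial_eq]
  simp [Finsupp.prod_fintype]

lemma coeff_alt {ℓ : ℕ} (γ : Fin ℓ → ℕ) (d : Fin ℓ →₀ ℕ) :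
    coeff d (alt γ) = ∑ σ : Equiv.Perm (Fin ℓ),
      (Equiv.Perm.sign σ : ℤ) * if expo (γ ∘ σ) = d then 1 else 0 := by
  rw [alt_eq_sum, coeff_sum]
  refine Finset.sum_congr rfl fun σ _ => ?_
  rw [Units.smul_def, coeff_smul, coeff_monomial, smul_eq_mul]

lemma coeff_alt_comm {ℓ : ℕ} (γ δ : Fin ℓ → ℕ) :
    coeff (expo γ) (alt δ) = coeff (expo δ) (alt γ) := by
  rw [coeff_alt, coeff_alt]
  refine Fintype.sum_equiv (Equiv.inv _) _ _ fun σ => ?_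
  simp only [Equiv.inv_apply, Equiv.Perm.sign_inv, EmbeddingLike.apply_eq_iff_eq]
  congr 2
  refine propext ⟨?_, ?_⟩
  · rintro rfl; ext i; simp
  · rintro rfl; ext i; simp

lemma coeff_alt_self {ℓ : ℕ} {γ : Fin ℓ → ℕ} (h : Function.Injective γ) :
    coeff (expo γ) (alt γ) = 1 := by
  rw [coeff_alt, Finset.sum_eq_single 1]
  · simp
  · intro σ _ hσ
    rw [if_neg, mul_zero]
    intro e
    apply hσ
    ext i
    have := congrFun (Finsupp.equivFunOnFinite.symm.injective e) i
    simpa using congrArg Fin.val (h this)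
  · simp

lemma alt_ne_zero {ℓ : ℕ} {γ : Fin ℓ → ℕ} (h : Function.Injective γ) : alt γ ≠ 0 := by
  intro h0
  have := coeff_alt_self h
  simp [h0] at this

/-- The power series whose coefficients are the values of a linear functional on the products of
complete homogeneous polynomials. -/
def completeDual {ℓ : ℕ} (φ : MvPolynomial (Fin ℓ) ℤ →ₗ[ℤ] ℤ) : MvPowerSeries (Fin ℓ) ℤ :=
  fun β => φ (∏ i, PowerSeries.coeff (β i) (completeSeries ℓ))

/-- Multiplication by an alternant turns the products of complete homogeneous polynomials into
Jacobi–Trudi determinants. -/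
lemma coeff_alt_mul_completeDual {ℓ : ℕ} (φ : MvPolynomial (Fin ℓ) ℤ →ₗ[ℤ] ℤ)
    (q l : Fin ℓ → ℕ) :
    MvPowerSeries.coeff (expo l) ((alt q : MvPowerSeries (Fin ℓ) ℤ) * completeDual φ) =
      φ (skew q l) := by
  have h1 : (alt q : MvPowerSeries (Fin ℓ) ℤ) = ∑ σ : Equiv.Perm (Fin ℓ),
      (Equiv.Perm.sign σ : ℤ) • MvPowerSeries.monomial (expo (q ∘ σ)) (1 : ℤ) := by
    rw [alt_eq_sum, ← MvPolynomial.coeToMvPowerSeries.ringHom_apply, map_sum]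
    refine Finset.sum_congr rfl fun σ _ => ?_
    rw [Units.smul_def, map_zsmul, MvPolynomial.coeToMvPowerSeries.ringHom_apply,
      MvPolynomial.coe_monomial]
  rw [h1, Finset.sum_mul, map_sum, skew, ← Matrix.det_transpose, Matrix.det_apply, map_sum]
  refine Finset.sum_congr rfl fun σ _ => ?_
  rw [Units.smul_def, map_zsmul, smul_mul_assoc, map_smul, MvPowerSeries.coeff_monomial_mul]
  congr 1
  split_ifs with h
  · rw [one_mul, MvPowerSeries.coeff_apply, completeDual]
    congr 1
    refine Finset.prod_congr rfl fun i _ => ?_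
    rw [Matrix.transpose_apply, Matrix.of_apply, PowerSeries.coeff_X_pow_mul',
      if_pos (by simpa using h i)]
    simp
  · obtain ⟨i, hi⟩ : ∃ i, ¬ q (σ i) ≤ l i := by
      by_contra! hc
      exact h fun i => by simpa using hc i
    rw [Finset.prod_eq_zero (Finset.mem_univ i), map_zero]
    rw [Matrix.transpose_apply, Matrix.of_apply, PowerSeries.coeff_X_pow_mul', if_neg hi]

/-- The functional `p ↦ [x ^ n] (a_δ p)`. On symmetric polynomials it is the coefficient of a Schur
polynomial. -/
def altCoeff {ℓ : ℕ} (n : Fin ℓ → ℕ) : MvPolynomial (Fin ℓ) ℤ →ₗ[ℤ] ℤ :=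
  (lcoeff ℤ (expo n)).comp (LinearMap.mulLeft ℤ (alt fun j : Fin ℓ => (j : ℕ)))

lemma altCoeff_apply {ℓ : ℕ} (n : Fin ℓ → ℕ) (p : MvPolynomial (Fin ℓ) ℤ) :
    altCoeff n p = coeff (expo n) (alt (fun j : Fin ℓ => (j : ℕ)) * p) := rfl

/-- Cauchy duality: the coefficients of a Schur polynomial are those of the products of complete
homogeneous polynomials in the basis of Schur polynomials. -/
lemma coe_skew_eq_completeDual {ℓ : ℕ} (n : Fin ℓ → ℕ) :
    (skew (fun j => (j : ℕ)) n : MvPowerSeries (Fin ℓ) ℤ) = completeDual (altCoeff n) := by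
  have hne : ((alt fun j : Fin ℓ => (j : ℕ)) : MvPowerSeries (Fin ℓ) ℤ) ≠ 0 := by
    rw [Ne, MvPolynomial.coe_eq_zero_iff]
    exact alt_ne_zero Fin.val_injective
  apply mul_left_cancel₀ hne
  rw [← MvPolynomial.coe_mul, mul_comm, skew_mul_alt]
  ext d
  obtain ⟨d, rfl⟩ := Finsupp.equivFunOnFinite.symm.surjective d
  rw [coeff_alt_mul_completeDual, altCoeff_apply, mul_comm, skew_mul_alt, MvPolynomial.coeff_coe,
    coeff_alt_comm]

/-- The coefficient of `a_l` in `a_q s_n`, and that of `s_n` in the skew Schur polynomial of `l`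
and `q`, agree. -/
lemma coeff_alt_mul_skew {ℓ : ℕ} (l q n : Fin ℓ → ℕ) :
    coeff (expo l) (alt q * skew (fun j => (j : ℕ)) n) =
      coeff (expo n) (alt (fun j => (j : ℕ)) * skew q l) := by
  rw [← altCoeff_apply, ← coeff_alt_mul_completeDual, ← coe_skew_eq_completeDual,
    ← MvPolynomial.coe_mul, MvPolynomial.coeff_coe]

end FermionBoson

/-! ### Homogeneity and antisymmetry -/

namespace FermionBoson

open MvPolynomial

/-- The coefficient of `X ^ k` is homogeneous of degree `k`. -/
def IsGraded {ℓ : ℕ} (f : PowerSeries (MvPolynomial (Fin ℓ) ℤ)) : Prop :=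
  ∀ k, (PowerSeries.coeff k f).IsHomogeneous k

lemma isGraded_completeSeries (ℓ : ℕ) : IsGraded (completeSeries ℓ) := by
  refine Finset.prod_induction _ IsGraded (fun f g hf hg k => ?_) (fun k => ?_) fun i _ k => ?_
  · rw [PowerSeries.coeff_mul]
    refine IsHomogeneous.sum _ _ _ fun p hp => ?_
    rw [← Finset.HasAntidiagonal.mem_antidiagonal.1 hp]
    exact (hf _).mul (hg _)
  · rw [PowerSeries.coeff_one]
    split_ifs with h
    · rw [h]; exact isHomogeneous_one _ _
    · exact isHomogeneous_zero _ _ _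
  · have h : (varSeq ℓ i).IsHomogeneous 1 := by
      rw [varSeq]
      split_ifs
      · exact isHomogeneous_X _ _
      · exact isHomogeneous_zero _ _ _
    rw [coeff_geo]
    simpa using h.pow k

lemma isHomogeneous_skew {ℓ d : ℕ} {q l : Fin ℓ → ℕ} (h : d + ∑ i, q i = ∑ i, l i) :
    (skew q l).IsHomogeneous d := by
  rw [skew, Matrix.det_apply]
  refine IsHomogeneous.sum _ _ _ fun σ _ => ?_
  rw [Units.smul_def, zsmul_eq_mul, ← eq_intCast (C : ℤ →+* MvPolynomial (Fin ℓ) ℤ)]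
  refine IsHomogeneous.C_mul ?_ _
  simp only [Matrix.of_apply, PowerSeries.coeff_X_pow_mul']
  by_cases hle : ∀ i, q i ≤ l (σ i)
  · have e : d = ∑ i, (l (σ i) - q i) := by
      have h1 : ∑ i, l (σ i) = ∑ i, l i := Equiv.sum_comp σ l
      have h2 : ∑ i, (l (σ i) - q i) + ∑ i, q i = ∑ i, l (σ i) := by
        rw [← Finset.sum_add_distrib]
        exact Finset.sum_congr rfl fun i _ => Nat.sub_add_cancel (hle i)
      omega
    rw [e]
    refine IsHomogeneous.prod _ _ _ fun i _ => ?_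
    rw [if_pos (hle i)]
    exact isGraded_completeSeries ℓ _
  · push Not at hle
    obtain ⟨i, hi⟩ := hle
    rw [Finset.prod_eq_zero (Finset.mem_univ i) (if_neg (not_le.2 hi))]
    exact isHomogeneous_zero _ _ _

lemma isHomogeneous_alt {ℓ : ℕ} (γ : Fin ℓ → ℕ) : (alt γ).IsHomogeneous (∑ i, γ i) := by
  rw [alt_eq_sum]
  refine IsHomogeneous.sum _ _ _ fun σ _ => ?_
  rw [Units.smul_def, zsmul_eq_mul, ← eq_intCast (C : ℤ →+* MvPolynomial (Fin ℓ) ℤ)]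
  refine IsHomogeneous.C_mul (isHomogeneous_monomial _ ?_) _
  rw [Finsupp.degree_eq_sum]
  exact Equiv.sum_comp σ γ

lemma sum_eq_of_coeff_ne_zero {ℓ d : ℕ} {p : MvPolynomial (Fin ℓ) ℤ} (hp : p.IsHomogeneous d)
    {α : Fin ℓ →₀ ℕ} (h : coeff α p ≠ 0) : ∑ i, α i = d := by
  rw [← Finsupp.degree_eq_sum]
  by_contra hne
  exact h (hp.coeff_eq_zero hne)

/-- Antisymmetric polynomials. -/
def IsAntisymmetric {ℓ : ℕ} (p : MvPolynomial (Fin ℓ) ℤ) : Prop :=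
  ∀ τ : Equiv.Perm (Fin ℓ), rename τ p = (Equiv.Perm.sign τ : ℤ) • p

lemma isAntisymmetric_alt {ℓ : ℕ} (γ : Fin ℓ → ℕ) : IsAntisymmetric (alt γ) := by
  intro τ
  rw [alt, AlgHom.map_det, zsmul_eq_mul, ← Matrix.det_permute']
  congr 1
  ext1 i j
  simp

lemma rename_skew {ℓ : ℕ} (q l : Fin ℓ → ℕ) (τ : Equiv.Perm (Fin ℓ)) :
    rename τ (skew q l) = skew q l := by
  have h : PowerSeries.map (rename τ : MvPolynomial (Fin ℓ) ℤ →ₐ[ℤ] _).toRingHom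
      (completeSeries ℓ) = completeSeries ℓ := by
    rw [completeSeries_eq_prod, map_prod,
      ← Equiv.prod_comp τ fun k => geo (X k : MvPolynomial (Fin ℓ) ℤ)]
    refine Finset.prod_congr rfl fun k _ => ?_
    ext1 n
    rw [PowerSeries.coeff_map, coeff_geo, coeff_geo, map_pow]
    simp
  rw [skew, AlgHom.map_det]
  congr 1
  ext1 i j
  conv_rhs => rw [Matrix.of_apply, PowerSeries.coeff_X_pow_mul', ← h, PowerSeries.coeff_map]
  simp only [AlgHom.mapMatrix_apply, Matrix.map_apply, Matrix.of_apply,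
    PowerSeries.coeff_X_pow_mul']
  split_ifs
  · rfl
  · simp

lemma IsAntisymmetric.mul_skew {ℓ : ℕ} {p : MvPolynomial (Fin ℓ) ℤ} (hp : IsAntisymmetric p)
    (q l : Fin ℓ → ℕ) : IsAntisymmetric (p * skew q l) := fun τ => by
  rw [map_mul, hp τ, rename_skew, smul_mul_assoc]

lemma IsAntisymmetric.coeff_comp {ℓ : ℕ} {p : MvPolynomial (Fin ℓ) ℤ} (hp : IsAntisymmetric p)
    (d : Fin ℓ → ℕ) (τ : Equiv.Perm (Fin ℓ)) :
    coeff (expo (d ∘ τ)) p = (Equiv.Perm.sign τ : ℤ) * coeff (expo d) p := by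
  have h : Finsupp.mapDomain τ (expo (d ∘ τ)) = expo d := by
    ext i
    obtain ⟨i, rfl⟩ := τ.surjective i
    rw [Finsupp.mapDomain_apply τ.injective]
    simp
  rw [← coeff_rename_mapDomain τ τ.injective, h, hp τ, coeff_smul, smul_eq_mul]

lemma IsAntisymmetric.coeff_eq_zero {ℓ : ℕ} {p : MvPolynomial (Fin ℓ) ℤ} (hp : IsAntisymmetric p)
    {d : Fin ℓ → ℕ} (hd : ¬ Function.Injective d) : coeff (expo d) p = 0 := by
  simp only [Function.Injective, not_forall] at hd
  obtain ⟨i, j, hij, hne⟩ := hd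
  have h : d ∘ Equiv.swap i j = d := by
    ext k
    rcases eq_or_ne k i with rfl | hk
    · simp [hij]
    · rcases eq_or_ne k j with rfl | hk'
      · simp [hij]
      · simp [Equiv.swap_apply_of_ne_of_ne hk hk']
  have := hp.coeff_comp d (Equiv.swap i j)
  rw [h, Equiv.Perm.sign_swap hne] at this
  simp only [Units.val_neg, Units.val_one] at this
  omega

lemma strictMono_eq_of_comp_eq {ℓ : ℕ} {l l' : Fin ℓ → ℕ} (hl : StrictMono l) (hl' : StrictMono l')
    {σ : Equiv.Perm (Fin ℓ)} (h : l ∘ σ = l') : l = l' := by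
  refine (hl.range_inj hl').1 ?_
  rw [← h, σ.surjective.range_comp]

lemma coeff_alt_of_strictMono {ℓ : ℕ} {l l' : Fin ℓ → ℕ} (hl : StrictMono l)
    (hl' : StrictMono l') : coeff (expo l') (alt l) = if l = l' then 1 else 0 := by
  split_ifs with h
  · rw [← h, coeff_alt_self hl.injective]
  · rw [coeff_alt]
    refine Finset.sum_eq_zero fun σ _ => ?_
    rw [if_neg, mul_zero]
    intro e
    exact h (strictMono_eq_of_comp_eq hl hl' (Finsupp.equivFunOnFinite.symm.injective e))

lemma IsAntisymmetric.ext {ℓ : ℕ} {p p' : MvPolynomial (Fin ℓ) ℤ} (hp : IsAntisymmetric p)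
    (hp' : IsAntisymmetric p')
    (h : ∀ l : Fin ℓ → ℕ, StrictMono l → coeff (expo l) p = coeff (expo l) p') : p = p' := by
  ext d
  obtain ⟨d, rfl⟩ := Finsupp.equivFunOnFinite.symm.surjective d
  by_cases hd : Function.Injective d
  · have hs : StrictMono (d ∘ Tuple.sort d) :=
      (Tuple.monotone_sort d).strictMono_of_injective (hd.comp (Tuple.sort d).injective)
    have e := h _ hs
    rw [hp.coeff_comp, hp'.coeff_comp] at e
    exact mul_left_cancel₀ (by simp) e
  · rw [hp.coeff_eq_zero hd, hp'.coeff_eq_zero hd]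

end FermionBoson

/-! ### Littlewood–Richardson coefficients -/

namespace SchurFunction

open FermionBoson MvPolynomial

lemma colLen_zero_le_iff {ρ : YoungDiagram} {n : ℕ} : ρ.colLen 0 ≤ n ↔ ρ.rowLen n = 0 := by
  rw [← not_lt, ← YoungDiagram.mem_iff_lt_colLen, YoungDiagram.mem_iff_lt_rowLen]
  omega

/-- The shifted row lengths of a diagram with at most `n` rows, in increasing order. -/
def rowBeta (n : ℕ) (ρ : YoungDiagram) : Fin n → ℕ := betaSeq fun i => ρ.rowLen i

lemma rowBeta_strictMono (n : ℕ) (ρ : YoungDiagram) : StrictMono (rowBeta n ρ) :=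
  betaSeq_strictMono fun _ _ h => ρ.rowLen_anti _ _ h

lemma betaSeq_injective {ℓ : ℕ} : Function.Injective (betaSeq (ℓ := ℓ)) := fun a b h => by
  ext i
  have := congrFun h i.rev
  simpa [betaSeq] using this

lemma rowBeta_injOn (n : ℕ) : Set.InjOn (rowBeta n) {ρ | ρ.colLen 0 ≤ n} := by
  intro ρ hρ ρ' hρ' h
  have h1 : ∀ i, ρ.rowLen i = ρ'.rowLen i := fun i => by
    by_cases hi : i < n
    · exact congrFun (betaSeq_injective h) ⟨i, hi⟩
    · rw [colLen_zero_le_iff.1 (le_trans hρ (not_lt.1 hi)),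
        colLen_zero_le_iff.1 (le_trans hρ' (not_lt.1 hi))]
  ext ⟨i, j⟩
  simp only [YoungDiagram.mem_cells, YoungDiagram.mem_iff_lt_rowLen, h1]

lemma rowLen_diagram {ℓ : ℕ} (lam : Fin ℓ → ℕ) (h : Antitone lam) (i : Fin ℓ) :
    (diagram lam h).rowLen i = lam i := by
  have := YoungDiagram.rowLen_ofRowLens (w := List.ofFn lam) (hw := h.sortedGE_ofFn)
    ⟨i, by simp⟩
  simpa [diagram] using this

lemma colLen_diagram_le {ℓ : ℕ} (lam : Fin ℓ → ℕ) (h : Antitone lam) :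
    (diagram lam h).colLen 0 ≤ ℓ := by
  rw [← not_lt, ← YoungDiagram.mem_iff_lt_colLen, diagram, YoungDiagram.mem_ofRowLens]
  simp

lemma rowBeta_diagram {ℓ : ℕ} (lam : Fin ℓ → ℕ) (h : Antitone lam) :
    rowBeta ℓ (diagram lam h) = betaSeq lam := by
  rw [rowBeta]
  congr 1
  ext i
  exact rowLen_diagram lam h i

lemma strictMono_add_le {n : ℕ} {l : Fin n → ℕ} (hl : StrictMono l) (a : Fin n) (k : ℕ)
    (h : a + k < n) : l a + k ≤ l ⟨a + k, h⟩ := by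
  induction k with
  | zero => exact le_rfl
  | succ k ih =>
    have h1 : l ⟨a + k, by omega⟩ < l ⟨a + (k + 1), h⟩ := hl (Fin.mk_lt_mk.2 (by omega))
    have := ih (by omega)
    omega

/-- Every strictly increasing sequence is the shifted sequence of row lengths of a diagram. -/
lemma exists_rowBeta_eq {n : ℕ} {l : Fin n → ℕ} (hl : StrictMono l) :
    ∃ ρ : YoungDiagram, ρ.colLen 0 ≤ n ∧ rowBeta n ρ = l := by
  have hle : ∀ i : Fin n, (i : ℕ) ≤ l i := fun i => by
    have := strictMono_add_le hl ⟨0, i.pos⟩ i (by simp)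
    simp only [zero_add, Fin.eta] at this
    omega
  have hanti : Antitone fun i : Fin n => l i.rev - i.rev := by
    intro i j hij
    have h1 : j.rev ≤ i.rev := Fin.rev_le_rev.2 hij
    have key : ∀ a b : Fin n, a ≤ b → l a + (b - a : ℕ) ≤ l b := by
      intro a b hab
      have := strictMono_add_le hl a (b - a) (by omega)
      simpa only [Nat.add_sub_cancel' (Fin.le_def.1 hab)] using this
    have := key _ _ h1
    have h2 : (j.rev : ℕ) ≤ i.rev := h1
    have := hle j.rev
    dsimp only
    omega
  refine ⟨diagram _ hanti, colLen_diagram_le _ _, ?_⟩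
  rw [rowBeta_diagram]
  ext i
  have := hle i
  simp only [betaSeq, Fin.rev_rev]
  omega

/-- The Schur polynomial as a polynomial. -/
def schurPoly (n : ℕ) (ρ : YoungDiagram) : MvPolynomial (Fin n) ℤ :=
  if ρ.colLen 0 ≤ n then skew (fun j => (j : ℕ)) (rowBeta n ρ) else 0

lemma schurPoly_mul_alt {n : ℕ} {ρ : YoungDiagram} (h : ρ.colLen 0 ≤ n) :
    schurPoly n ρ * alt (fun j => (j : ℕ)) = alt (rowBeta n ρ) := by
  rw [schurPoly, if_pos h, skew_mul_alt]

lemma alternant_eq (n : ℕ) (α : ℕ → ℕ) :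
    alternant n α = (Equiv.Perm.sign (Fin.revPerm (n := n)) : ℤ) •
      alt (betaSeq fun i : Fin n => α i) := by
  rw [alternant, ← Matrix.det_transpose, alt, zsmul_eq_mul, ← Matrix.det_permute]
  congr 1
  ext1 i j
  simp only [Matrix.transpose_apply, Matrix.of_apply, Matrix.submatrix_apply, id, betaSeq,
    Fin.revPerm_apply, Fin.val_rev]
  rw [show n - (n - (i + 1) + 1) = i by omega, show n - 1 - (i : ℕ) = n - (i + 1) by omega]

lemma schur_eq (n : ℕ) (ρ : YoungDiagram) :
    schur n ρ = algebraMap (MvPolynomial (Fin n) ℤ) _ (schurPoly n ρ) := by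
  by_cases h : ρ.colLen 0 ≤ n
  · have h0 : (betaSeq fun _ : Fin n => (0 : ℕ → ℕ) 0) = fun j : Fin n => (j : ℕ) := by
      ext i; simp [betaSeq]
    have hne : algebraMap (MvPolynomial (Fin n) ℤ) (FractionRing (MvPolynomial (Fin n) ℤ))
        (alternant n 0) ≠ 0 := by
      rw [Ne, FaithfulSMul.algebraMap_eq_zero_iff, alternant_eq]
      refine smul_ne_zero (by simp) (alt_ne_zero ?_)
      exact h0 ▸ Fin.val_injective
    rw [schur, if_pos h, div_eq_iff hne, ← map_mul, alternant_eq, alternant_eq, mul_smul_comm]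
    congr 2
    exact (h0 ▸ schurPoly_mul_alt h).symm
  · rw [schur, if_neg h, schurPoly, if_neg h, map_zero]

/-- The expansion of the product in `n` variables. -/
def ExpandsAt (μ ν : YoungDiagram) (n : ℕ) (c : YoungDiagram →₀ ℤ) : Prop :=
  schurPoly n μ * schurPoly n ν = c.sum fun ρ a => a • schurPoly n ρ

lemma isExpansion_iff {μ ν : YoungDiagram} {c : YoungDiagram →₀ ℤ} :
    IsExpansion μ ν c ↔ ∀ n, ExpandsAt μ ν n c := by
  refine forall_congr' fun n => ?_
  rw [ExpandsAt, ← (FaithfulSMul.algebraMap_injective (MvPolynomial (Fin n) ℤ)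
    (FractionRing (MvPolynomial (Fin n) ℤ))).eq_iff]
  simp only [schur_eq, map_mul, Finsupp.sum, map_sum, map_zsmul]

/-- The product of an alternant and a Schur polynomial whose expansion in alternants gives the
Littlewood–Richardson coefficients. -/
def altSchur (n : ℕ) (μ ν : YoungDiagram) : MvPolynomial (Fin n) ℤ :=
  alt (rowBeta n μ) * skew (fun j => (j : ℕ)) (rowBeta n ν)

lemma expandsAt_iff {μ ν : YoungDiagram} {n : ℕ} (hμ : μ.colLen 0 ≤ n) (hν : ν.colLen 0 ≤ n)
    {c : YoungDiagram →₀ ℤ} : ExpandsAt μ ν n c ↔ altSchur n μ ν =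
      c.sum fun ρ a => if ρ.colLen 0 ≤ n then a • alt (rowBeta n ρ) else 0 := by
  have hne : alt (fun j : Fin n => (j : ℕ)) ≠ 0 := alt_ne_zero Fin.val_injective
  have h1 : schurPoly n μ * schurPoly n ν * alt (fun j : Fin n => (j : ℕ)) = altSchur n μ ν := by
    rw [mul_right_comm, schurPoly_mul_alt hμ, altSchur, schurPoly, if_pos hν]
  have h2 : (c.sum fun ρ a => a • schurPoly n ρ) * alt (fun j : Fin n => (j : ℕ)) =
      c.sum fun ρ a => if ρ.colLen 0 ≤ n then a • alt (rowBeta n ρ) else 0 := by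
    rw [Finsupp.sum, Finset.sum_mul]
    refine Finset.sum_congr rfl fun ρ _ => ?_
    dsimp only
    split_ifs with h
    · rw [smul_mul_assoc, schurPoly_mul_alt h]
    · rw [schurPoly, if_neg h, smul_zero, zero_mul]
  rw [← h1, ← h2, ExpandsAt, mul_left_inj' hne]

lemma coeff_sum_alt {n : ℕ} (c : YoungDiagram →₀ ℤ) {ρ : YoungDiagram} (hρ : ρ.colLen 0 ≤ n) :
    coeff (expo (rowBeta n ρ))
      (c.sum fun ρ a => if ρ.colLen 0 ≤ n then a • alt (rowBeta n ρ) else 0) = c ρ := by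
  classical
  rw [Finsupp.sum, coeff_sum]
  have h : ∀ ρ' ∈ c.support, coeff (expo (rowBeta n ρ))
      (if ρ'.colLen 0 ≤ n then c ρ' • alt (rowBeta n ρ') else 0) = if ρ' = ρ then c ρ' else 0 := by
    intro ρ' _
    split_ifs with h1 h2 h2
    · rw [coeff_smul, h2, coeff_alt_self (rowBeta_strictMono n ρ).injective, smul_eq_mul, mul_one]
    · rw [coeff_smul, coeff_alt_of_strictMono (rowBeta_strictMono n ρ') (rowBeta_strictMono n ρ),
        if_neg fun e => h2 (rowBeta_injOn n h1 hρ e), smul_zero]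
    · exact absurd (h2 ▸ hρ) h1
    · exact coeff_zero _
  rw [Finset.sum_congr rfl h, Finset.sum_ite_eq']
  split_ifs with hc
  · rfl
  · exact (Finsupp.notMem_support_iff.1 hc).symm

lemma ExpandsAt.apply_eq {μ ν : YoungDiagram} {n : ℕ} (hμ : μ.colLen 0 ≤ n) (hν : ν.colLen 0 ≤ n)
    {c : YoungDiagram →₀ ℤ} (h : ExpandsAt μ ν n c) {ρ : YoungDiagram} (hρ : ρ.colLen 0 ≤ n) :
    c ρ = coeff (expo (rowBeta n ρ)) (altSchur n μ ν) := by
  rw [(expandsAt_iff hμ hν).1 h, coeff_sum_alt c hρ]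

lemma exists_expandsAt {μ ν : YoungDiagram} {n : ℕ} (hμ : μ.colLen 0 ≤ n) (hν : ν.colLen 0 ≤ n) :
    ∃ c, ExpandsAt μ ν n c ∧ ∀ ρ, c ρ ≠ 0 →
      ρ.colLen 0 ≤ n ∧ coeff (expo (rowBeta n ρ)) (altSchur n μ ν) ≠ 0 := by
  classical
  set f : YoungDiagram → ℤ := fun ρ =>
    if ρ.colLen 0 ≤ n then coeff (expo (rowBeta n ρ)) (altSchur n μ ν) else 0 with hf
  have hsupp : ∀ ρ, f ρ ≠ 0 →
      ρ.colLen 0 ≤ n ∧ coeff (expo (rowBeta n ρ)) (altSchur n μ ν) ≠ 0 := by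
    intro ρ h
    simp only [hf] at h
    split_ifs at h with h1
    · exact ⟨h1, h⟩
    · exact absurd rfl h
  have hfin : (Function.support f).Finite := by
    refine Set.Finite.of_finite_image (f := fun ρ => expo (rowBeta n ρ))
      ((altSchur n μ ν).support.finite_toSet.subset ?_) ?_
    · rintro _ ⟨ρ, hρ, rfl⟩
      simpa using (hsupp ρ hρ).2
    · intro ρ hρ ρ' hρ' h
      exact rowBeta_injOn n (hsupp ρ hρ).1 (hsupp ρ' hρ').1
        (Finsupp.equivFunOnFinite.symm.injective h)
  refine ⟨Finsupp.ofSupportFinite f hfin, (expandsAt_iff hμ hν).2 ?_, hsupp⟩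
  have hanti : IsAntisymmetric ((Finsupp.ofSupportFinite f hfin).sum fun ρ a =>
      if ρ.colLen 0 ≤ n then a • alt (rowBeta n ρ) else 0) := by
    intro τ
    rw [Finsupp.sum, map_sum, Finset.smul_sum]
    refine Finset.sum_congr rfl fun ρ _ => ?_
    split_ifs
    · rw [map_zsmul, isAntisymmetric_alt _ τ, smul_comm]
    · simp
  refine ((isAntisymmetric_alt _).mul_skew _ _).ext hanti fun l hl => ?_
  obtain ⟨ρ, hρ, rfl⟩ := exists_rowBeta_eq hl
  rw [coeff_sum_alt _ hρ, Finsupp.ofSupportFinite_coe, hf]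
  simp only [if_pos hρ]
  rfl

/-- Setting the first variable to zero. -/
def dropVar (n : ℕ) : MvPolynomial (Fin (n + 1)) ℤ →ₐ[ℤ] MvPolynomial (Fin n) ℤ :=
  aeval (Fin.cases 0 X)

lemma dropVar_alt {n : ℕ} {γ : Fin (n + 1) → ℕ} {γ' : Fin n → ℕ}
    (h : ∀ i : Fin n, γ i.succ = γ' i + 1) :
    dropVar n (alt γ) = 0 ^ γ 0 * ((∏ j, X j) * alt γ') := by
  rw [alt, AlgHom.map_det, Matrix.det_succ_column_zero, Fin.sum_univ_succ, Finset.sum_eq_zero,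
    add_zero]
  · have h1 : ((AlgHom.mapMatrix (dropVar n)) (Matrix.of fun i j : Fin (n + 1) =>
        (X j : MvPolynomial (Fin (n + 1)) ℤ) ^ γ i)).submatrix (Fin.succAbove 0) Fin.succ =
        Matrix.of fun i j : Fin n => (X j : MvPolynomial (Fin n) ℤ) *
          (Matrix.of fun i j : Fin n => (X j : MvPolynomial (Fin n) ℤ) ^ γ' i) i j := by
      ext1 i j
      simp [dropVar, h, pow_succ']
    rw [h1, Matrix.det_mul_row, alt]
    simp [dropVar]
  · intro i _
    simp [dropVar, h]

lemma dropVar_schurPoly (n : ℕ) (ρ : YoungDiagram) :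
    dropVar n (schurPoly (n + 1) ρ) = schurPoly n ρ := by
  have hδ : dropVar n (alt fun j : Fin (n + 1) => (j : ℕ)) =
      (∏ j, X j) * alt fun j : Fin n => (j : ℕ) := by
    rw [dropVar_alt (γ' := fun j : Fin n => (j : ℕ)) (by simp)]
    simp
  have hne : (∏ j, X j) * alt (fun j : Fin n => (j : ℕ)) ≠ 0 :=
    mul_ne_zero (Finset.prod_ne_zero_iff.2 fun j _ => X_ne_zero j) (alt_ne_zero Fin.val_injective)
  by_cases h : ρ.colLen 0 ≤ n + 1
  · apply mul_right_cancel₀ hne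
    rw [← hδ, ← map_mul, schurPoly_mul_alt h, hδ, dropVar_alt (γ' := rowBeta n ρ)]
    · have h0 : rowBeta (n + 1) ρ 0 = ρ.rowLen n := by simp [rowBeta, betaSeq]
      rw [h0]
      by_cases h' : ρ.colLen 0 ≤ n
      · rw [mul_left_comm (schurPoly n ρ), schurPoly_mul_alt h', colLen_zero_le_iff.1 h', pow_zero,
          one_mul]
      · rw [schurPoly, if_neg h', zero_mul, zero_pow fun e => h' (colLen_zero_le_iff.2 e), zero_mul]
    · intro i
      simp only [rowBeta, betaSeq, Fin.val_rev, Fin.val_succ]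
      rw [show n + 1 - (i + 1 + 1) = n - (i + 1) by omega]
      ring
  · rw [schurPoly, if_neg h, schurPoly, if_neg (by omega), map_zero]

lemma ExpandsAt.mono {μ ν : YoungDiagram} {n N : ℕ} (h : n ≤ N) {c : YoungDiagram →₀ ℤ}
    (hc : ExpandsAt μ ν N c) : ExpandsAt μ ν n c := by
  induction N, h using Nat.le_induction with
  | base => exact hc
  | succ N _ ih =>
    apply ih
    have := congrArg (dropVar N) hc
    simpa only [ExpandsAt, map_mul, Finsupp.sum, map_sum, map_zsmul, dropVar_schurPoly] using this

lemma sum_rowLen_eq {ρ : YoungDiagram} {n : ℕ} (h : ρ.colLen 0 ≤ n) :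
    ∑ i : Fin n, ρ.rowLen i = ∑ i ∈ Finset.range (ρ.colLen 0), ρ.rowLen i := by
  rw [Fin.sum_univ_eq_sum_range]
  symm
  refine Finset.sum_subset (by simpa using h) fun i _ hi => ?_
  exact colLen_zero_le_iff.1 (by simpa using hi)

lemma sum_betaSeq {ℓ : ℕ} (lam : Fin ℓ → ℕ) :
    ∑ i, betaSeq lam i = ∑ i, lam i + ∑ i : Fin ℓ, (i : ℕ) := by
  simp only [betaSeq, Finset.sum_add_distrib]
  rw [← Equiv.sum_comp Fin.revPerm lam]
  rfl

lemma colLen_le_sum (ρ : YoungDiagram) :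
    ρ.colLen 0 ≤ ∑ i ∈ Finset.range (ρ.colLen 0), ρ.rowLen i := by
  have := Finset.card_nsmul_le_sum (Finset.range (ρ.colLen 0)) ρ.rowLen 1 fun i hi => by
    have h := Finset.mem_range.1 hi
    rw [← YoungDiagram.mem_iff_lt_colLen, YoungDiagram.mem_iff_lt_rowLen] at h
    exact h
  simpa using this

/-- Products of Schur functions expand in Schur functions, uniformly in the number of variables. -/
lemma exists_isExpansion (μ ν : YoungDiagram) : ∃ c, IsExpansion μ ν c := by
  set D := ∑ i ∈ Finset.range (μ.colLen 0), μ.rowLen i +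
    ∑ i ∈ Finset.range (ν.colLen 0), ν.rowLen i with hD
  have hμ := colLen_le_sum μ
  have hν := colLen_le_sum ν
  -- Homogeneity bounds the number of rows in the expansion by `D`.
  have hrows : ∀ n ρ, D ≤ n → ρ.colLen 0 ≤ n →
      coeff (expo (rowBeta n ρ)) (altSchur n μ ν) ≠ 0 → ρ.colLen 0 ≤ D := by
    intro n ρ hn hρ hc
    have h1 : (skew (fun j : Fin n => (j : ℕ)) (rowBeta n ν)).IsHomogeneous
        (∑ i : Fin n, ν.rowLen i) := isHomogeneous_skew (sum_betaSeq _).symm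
    have h2 := sum_eq_of_coeff_ne_zero ((isHomogeneous_alt (rowBeta n μ)).mul h1) hc
    have h3 : ∑ i, rowBeta n ρ i = ∑ i, rowBeta n μ i + ∑ i : Fin n, ν.rowLen i := h2
    rw [rowBeta, rowBeta, sum_betaSeq, sum_betaSeq, sum_rowLen_eq hρ,
      sum_rowLen_eq (by omega : μ.colLen 0 ≤ n), sum_rowLen_eq (by omega : ν.colLen 0 ≤ n)] at h3
    have := colLen_le_sum ρ
    omega
  obtain ⟨c, hc, hcs⟩ := exists_expandsAt (μ := μ) (ν := ν) (n := D) (by omega) (by omega)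
  refine ⟨c, isExpansion_iff.2 fun n => ?_⟩
  rcases le_total n D with hn | hn
  · exact hc.mono hn
  · obtain ⟨c', hc', hcs'⟩ := exists_expandsAt (μ := μ) (ν := ν) (n := n) (by omega) (by omega)
    convert hc'
    ext ρ
    by_cases hρ : ρ.colLen 0 ≤ D
    · rw [hc.apply_eq (by omega) (by omega) hρ, (hc'.mono hn).apply_eq (by omega) (by omega) hρ]
    · have h1 : c ρ = 0 := by
        by_contra h
        exact hρ (hcs ρ h).1
      have h2 : c' ρ = 0 := by
        by_contra h
        exact hρ (hrows n ρ hn (hcs' ρ h).1 (hcs' ρ h).2)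
      rw [h1, h2]

/-- The Littlewood–Richardson coefficient as a coefficient of the Schur polynomial `s_ν` in the skew
Schur polynomial `s_{λ/μ}`. -/
theorem lrCoeff_diagram {ℓ : ℕ} (lam mu nu : Fin ℓ → ℕ) (hlam : Antitone lam) (hmu : Antitone mu)
    (hnu : Antitone nu) :
    lrCoeff (diagram lam hlam) (diagram mu hmu) (diagram nu hnu) =
      coeff (expo (betaSeq nu)) (alt (fun j => (j : ℕ)) * skew (betaSeq mu) (betaSeq lam)) := by
  have h := exists_isExpansion (diagram mu hmu) (diagram nu hnu)
  rw [lrCoeff, dif_pos h, (isExpansion_iff.1 h.choose_spec ℓ).apply_eq (colLen_diagram_le _ _)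
    (colLen_diagram_le _ _) (colLen_diagram_le _ _), altSchur, rowBeta_diagram, rowBeta_diagram,
    rowBeta_diagram, coeff_alt_mul_skew]

end SchurFunction

/-! ### Degrees in a single variable -/

namespace FermionBoson

open MvPolynomial

/-- All coefficients of the vector have degree at most `d` in the variable `k`. -/
def DegreeLE {ℓ : ℕ} (k : Fin ℓ) (d : ℕ) (v : Fock (MvPolynomial (Fin ℓ) ℤ)) : Prop :=
  ∀ s, degreeOf k (v s) ≤ d

variable {ℓ : ℕ} {k : Fin ℓ}

lemma DegreeLE.zero (d : ℕ) : DegreeLE k d 0 := fun s => by simp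

lemma DegreeLE.add {d : ℕ} {v w : Fock (MvPolynomial (Fin ℓ) ℤ)} (hv : DegreeLE k d v)
    (hw : DegreeLE k d w) : DegreeLE k d (v + w) := fun s => by
  rw [Finsupp.add_apply]
  exact (degreeOf_add_le _ _ _).trans (max_le (hv s) (hw s))

lemma DegreeLE.ket (d : ℕ) (t : Config) :
    DegreeLE k d (ket (MvPolynomial (Fin ℓ) ℤ) t) := fun s => by
  classical
  rw [FermionBoson.ket, Finsupp.single_apply]
  split_ifs <;> simp

lemma DegreeLE.X_smul_ket (i : Fin ℓ) (t : Config) :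
    DegreeLE k (if i = k then 1 else 0)
      ((X i : MvPolynomial (Fin ℓ) ℤ) • FermionBoson.ket (MvPolynomial (Fin ℓ) ℤ) t) := fun s => by
  classical
  rw [FermionBoson.ket, Finsupp.smul_single, Finsupp.single_apply]
  split_ifs with h1 h2 h2
  · simp [h2]
  · rw [smul_eq_mul, mul_one, degreeOf_X, if_neg (Ne.symm h2)]
  · simp
  · simp

/-- Degree bounds on the images of the basis vectors add to those of the vector. -/
lemma DegreeLE.map {d e : ℕ} {A : Module.End (MvPolynomial (Fin ℓ) ℤ) (Fock _)}
    (hA : ∀ s, DegreeLE k e (A (FermionBoson.ket _ s))) {v : Fock (MvPolynomial (Fin ℓ) ℤ)}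
    (hv : DegreeLE k d v) : DegreeLE k (d + e) (A v) := fun t => by
  have h : A v = v.sum fun s c => c • A (FermionBoson.ket _ s) := by
    conv_lhs => rw [← Finsupp.sum_single v]
    rw [Finsupp.sum, map_sum]
    refine Finset.sum_congr rfl fun s _ => ?_
    dsimp only
    rw [← map_smul, FermionBoson.ket, Finsupp.smul_single, smul_eq_mul, mul_one]
  rw [h, Finsupp.sum, Finsupp.finsetSum_apply]
  refine (degreeOf_sum_le _ _ _).trans (Finset.sup_le fun s _ => ?_)
  rw [Finsupp.smul_apply, smul_eq_mul]
  exact (degreeOf_mul_le _ _ _).trans (add_le_add (hv s) (hA s t))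

lemma degreeLE_lMatrix (i : Fin ℓ) (j : ℕ) (a b : Fin 3) (t : Config) :
    DegreeLE k (if i = k then 1 else 0)
      (lMatrix (X i : MvPolynomial (Fin ℓ) ℤ) j a b (ket _ t)) := by
  obtain ⟨s, m⟩ := t
  by_cases h : j ∈ s
  · obtain ⟨e1, e2, e3, e4, e5, e6, e7, e8, e9⟩ :=
      lMatrix_ket_of_mem (X i : MvPolynomial (Fin ℓ) ℤ) h m
    rcases fin_three_cases a with rfl | rfl | rfl <;>
    rcases fin_three_cases b with rfl | rfl | rfl <;>
    simp only [e1, e2, e3, e4, e5, e6, e7, e8, e9]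
    exacts [.ket _ _, .X_smul_ket _ _, .zero _, .zero _, .zero _, .zero _, .ket _ _,
      .X_smul_ket _ _, .zero _]
  · obtain ⟨e1, e2, e3, e4, e5, e6, e7, e8, e9⟩ :=
      lMatrix_ket_of_notMem (X i : MvPolynomial (Fin ℓ) ℤ) h m
    have h4 : DegreeLE k (if i = k then 1 else 0)
        (if m j = 0 then 0 else ket (MvPolynomial (Fin ℓ) ℤ) (s, m - Finsupp.single j 1)) := by
      by_cases h0 : m j = 0
      · rw [if_pos h0]; exact DegreeLE.zero _
      · rw [if_neg h0]; exact DegreeLE.ket _ _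
    rcases fin_three_cases a with rfl | rfl | rfl <;>
    rcases fin_three_cases b with rfl | rfl | rfl <;>
    simp only [e1, e2, e3, e4, e5, e6, e7, e8, e9]
    exacts [.ket _ _, .X_smul_ket _ _, .X_smul_ket _ _, h4, .X_smul_ket _ _, .zero _, .zero _,
      .zero _, .X_smul_ket _ _]

lemma degreeLE_monodromy (i : Fin ℓ) (n : ℕ) (a b : Fin 3) (t : Config) :
    DegreeLE k ((if i = k then 1 else 0) * n)
      (monodromy (X i : MvPolynomial (Fin ℓ) ℤ) n a b (ket _ t)) := by
  induction n generalizing b t with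
  | zero =>
    by_cases h : a = b
    · subst h
      simpa [monodromy] using DegreeLE.ket _ t
    · simpa [monodromy, Matrix.one_apply_ne h] using DegreeLE.zero _
  | succ n ih =>
    rw [monodromy_succ_apply, mul_add, mul_one, add_comm]
    exact (((degreeLE_lMatrix i n 0 b t).map fun s => ih 0 s).add
      ((degreeLE_lMatrix i n 1 b t).map fun s => ih 1 s)).add
        ((degreeLE_lMatrix i n 2 b t).map fun s => ih 2 s)

lemma degreeLE_prod_monodromy (is : List (Fin ℓ)) (n : ℕ) (t : Config) :
    DegreeLE k (is.count k * n) (((is.map X).map fun x : MvPolynomial (Fin ℓ) ℤ =>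
      monodromy x n 0 0).prod (ket _ t)) := by
  induction is with
  | nil => simpa using DegreeLE.ket _ t
  | cons i is ih =>
    rw [List.count_cons, add_mul, List.map_cons, List.map_cons, List.prod_cons,
      Module.End.mul_apply]
    refine ih.map fun s => ?_
    simpa using degreeLE_monodromy i n 0 0 s

lemma completeSeries_eq_prod_list (ℓ : ℕ) :
    completeSeries ℓ = (((List.finRange ℓ).map X).map geo).prod := by
  rw [List.map_map, ← List.ofFn_eq_map, List.prod_ofFn, completeSeries_eq_prod]
  rfl

/-- A skew Schur polynomial is a matrix element of a product of transfer matrices over `N` sites,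
and each site contributes at most one power of the spectral parameter. -/
lemma degreeOf_skew_le {N : ℕ} {lam mu : Fin ℓ → ℕ} (hlam : Antitone lam) (hmu : Antitone mu)
    (hlamN : ∀ i, lam i < N) (hmuN : ∀ i, mu i < N) (k : Fin ℓ) :
    degreeOf k (skew (betaSeq mu) (betaSeq lam)) ≤ N := by
  rw [skew, completeSeries_eq_prod_list, ← prod_monodromy_apply_eq_det hlam hmu hlamN hmuN]
  refine (degreeLE_prod_monodromy _ N _ _).trans ?_
  rw [List.count_eq_one_of_mem (List.nodup_finRange ℓ) (List.mem_finRange k), one_mul]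

lemma degreeOf_alt_val_le (k : Fin ℓ) : degreeOf k (alt fun j : Fin ℓ => (j : ℕ)) ≤ ℓ - 1 := by
  rw [degreeOf_le_iff]
  intro d hd
  rw [mem_support_iff, coeff_alt] at hd
  obtain ⟨σ, -, hσ⟩ := Finset.exists_ne_zero_of_sum_ne_zero hd
  split_ifs at hσ with h
  · rw [← h]
    simp only [Finsupp.equivFunOnFinite_symm_apply_apply, Function.comp_apply]
    omega
  · simp at hσ

lemma apply_le_of_mem_support {N : ℕ} {lam mu : Fin ℓ → ℕ} (hlam : Antitone lam)
    (hmu : Antitone mu) (hlamN : ∀ i, lam i < N) (hmuN : ∀ i, mu i < N) {α : Fin ℓ →₀ ℕ}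
    (hα : α ∈ (alt (fun j => (j : ℕ)) * skew (betaSeq mu) (betaSeq lam)).support) (k : Fin ℓ) :
    α k ≤ ℓ - 1 + N :=
  (degreeOf_le_iff.1 ((degreeOf_mul_le _ _ _).trans (add_le_add (degreeOf_alt_val_le k)
    (degreeOf_skew_le hlam hmu hlamN hmuN k)))) α hα

end FermionBoson

/-! ### Divided differences of antisymmetric polynomials -/

namespace FermionBoson

open MvPolynomial

variable {K : Type*} [Field K] {ℓ : ℕ}

/-- The linear functional on polynomials that replaces `x_j ^ a` with `f j (M - a)`. The exponent
`M - a` is that of `x_j⁻¹` after `x_j ^ M` has been taken out; the degrees must be at most `M`. -/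
def pairing (M : ℕ) (f : Fin ℓ → ℕ → K) : MvPolynomial (Fin ℓ) ℤ →ₗ[ℤ] K :=
  (basisMonomials (Fin ℓ) ℤ).constr ℤ fun α => ∏ j, f j (M - α j)

lemma pairing_monomial (M : ℕ) (f : Fin ℓ → ℕ → K) (α : Fin ℓ →₀ ℕ) (a : ℤ) :
    pairing M f (monomial α a) = a • ∏ j, f j (M - α j) := by
  have h : monomial α a = a • (basisMonomials (Fin ℓ) ℤ) α := by
    rw [coe_basisMonomials, smul_monomial, smul_eq_mul, mul_one]
  rw [h, map_smul, pairing, Module.Basis.constr_basis]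

lemma pairing_eq_sum (M : ℕ) (f : Fin ℓ → ℕ → K) (A : MvPolynomial (Fin ℓ) ℤ) :
    pairing M f A = ∑ α ∈ A.support, coeff α A • ∏ j, f j (M - α j) := by
  conv_lhs => rw [A.as_sum]
  rw [map_sum]
  exact Finset.sum_congr rfl fun α _ => pairing_monomial _ _ _ _

lemma pairing_rename (M : ℕ) (f : Fin ℓ → ℕ → K) (τ : Equiv.Perm (Fin ℓ))
    (A : MvPolynomial (Fin ℓ) ℤ) : pairing M f (rename τ A) = pairing M (f ∘ τ) A := by
  conv_lhs => rw [A.as_sum, map_sum, map_sum]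
  rw [pairing_eq_sum]
  refine Finset.sum_congr rfl fun α _ => ?_
  rw [rename_monomial, pairing_monomial, ← Equiv.prod_comp τ]
  simp only [Finsupp.mapDomain_apply τ.injective, Function.comp_apply]

lemma pairing_comp_perm {A : MvPolynomial (Fin ℓ) ℤ} (hA : IsAntisymmetric A) (M : ℕ)
    (f : Fin ℓ → ℕ → K) (τ : Equiv.Perm (Fin ℓ)) :
    pairing M (f ∘ τ) A = (Equiv.Perm.sign τ : ℤ) • pairing M f A := by
  rw [← pairing_rename, hA τ, map_smul]

lemma pairing_eq_zero [CharZero K] {A : MvPolynomial (Fin ℓ) ℤ} (hA : IsAntisymmetric A) (M : ℕ)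
    (φ : Fin ℓ → ℕ → K) {g : Fin ℓ → Fin ℓ} (hg : ¬ Function.Injective g) :
    pairing M (φ ∘ g) A = 0 := by
  simp only [Function.Injective, not_forall] at hg
  obtain ⟨i, j, hij, hne⟩ := hg
  have h : (φ ∘ g) ∘ Equiv.swap i j = φ ∘ g := by
    funext k
    rcases eq_or_ne k i with rfl | hk
    · simp [hij]
    · rcases eq_or_ne k j with rfl | hk'
      · simp [hij]
      · simp [Equiv.swap_apply_of_ne_of_ne hk hk']
  have := pairing_comp_perm hA M (φ ∘ g) (Equiv.swap i j)
  rw [h, Equiv.Perm.sign_swap hne] at this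
  simp only [Units.val_neg, Units.val_one, neg_smul, one_smul] at this
  exact self_eq_neg.1 this

/-- On an antisymmetric polynomial the pairing is alternating in its functions. -/
lemma pairing_sum_mul [CharZero K] {A : MvPolynomial (Fin ℓ) ℤ} (hA : IsAntisymmetric A) (M : ℕ)
    (φ : Fin ℓ → ℕ → K) (B : Matrix (Fin ℓ) (Fin ℓ) K) :
    pairing M (fun j b => ∑ k, B k j * φ k b) A = B.det * pairing M φ A := by
  have h1 : pairing M (fun j b => ∑ k, B k j * φ k b) A =
      ∑ g : Fin ℓ → Fin ℓ, (∏ j, B (g j) j) * pairing M (φ ∘ g) A := by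
    simp only [pairing_eq_sum, Finset.mul_sum]
    rw [Finset.sum_comm]
    refine Finset.sum_congr rfl fun α _ => ?_
    rw [Finset.prod_univ_sum, Finset.smul_sum, Fintype.piFinset_univ]
    refine Finset.sum_congr rfl fun g _ => ?_
    rw [Finset.prod_mul_distrib, mul_smul_comm]
    rfl
  rw [h1, Matrix.det_apply', Finset.sum_mul]
  symm
  refine Finset.sum_of_injOn (fun σ : Equiv.Perm (Fin ℓ) => (σ : Fin ℓ → Fin ℓ)) ?_ ?_ ?_ ?_
  · intro σ _ τ _ h; exact DFunLike.coe_injective h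
  · intro σ _; simp
  · intro g _ hg
    rw [pairing_eq_zero hA M φ, mul_zero]
    intro hinj
    exact hg ⟨Equiv.ofBijective g (Finite.injective_iff_bijective.1 hinj), by simp, rfl⟩
  · intro σ _
    rw [pairing_comp_perm hA, zsmul_eq_mul]
    ring

lemma newton_swap_of_ne (u : ℕ → K) {i k : ℕ} (h : k ≠ i) :
    newton (u ∘ Equiv.swap i (i + 1)) k = newton u k := by
  rw [newton, newton]
  congr 1
  rcases lt_or_gt_of_ne h with h | h
  · refine Finset.prod_congr rfl fun j hj => ?_
    have := Finset.mem_range.1 hj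
    rw [Function.comp_apply, Equiv.swap_apply_of_ne_of_ne (by omega) (by omega)]
  · refine Finset.prod_equiv (Equiv.swap i (i + 1)) (fun j => ?_) fun j _ => rfl
    simp only [Finset.mem_range]
    rcases eq_or_ne j i with rfl | h1
    · simp; omega
    · rcases eq_or_ne j (i + 1) with rfl | h2
      · simp; omega
      · rw [Equiv.swap_apply_of_ne_of_ne h1 h2]

/-- The recursion of divided differences. -/
lemma newton_sub_newton_swap (u : ℕ → K) (i : ℕ) :
    newton u i - newton (u ∘ Equiv.swap i (i + 1)) i =
      PowerSeries.C (u i - u (i + 1)) * newton u (i + 1) := by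
  have h : ∏ j ∈ Finset.range i, geo ((u ∘ Equiv.swap i (i + 1)) j) =
      ∏ j ∈ Finset.range i, geo (u j) := by
    refine Finset.prod_congr rfl fun j hj => ?_
    have := Finset.mem_range.1 hj
    rw [Function.comp_apply, Equiv.swap_apply_of_ne_of_ne (by omega) (by omega)]
  have hg := geo_sub_geo (u i) (u (i + 1))
  rw [newton, newton, newton, Finset.prod_range_succ, Finset.prod_range_succ, h,
    Finset.prod_range_succ, Finset.prod_range_succ, Function.comp_apply, Equiv.swap_apply_left,
    pow_succ]
  linear_combination (PowerSeries.X ^ i * ∏ j ∈ Finset.range i, geo (u j)) * hg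

/-- In the variable `j`, the divided difference at `u 0, …, u (k j)` of the power with exponent `b`,
as a function of `b`. -/
def newtonFun (u : ℕ → K) (k : Fin ℓ → ℕ) : Fin ℓ → ℕ → K :=
  fun j b => PowerSeries.coeff b (newton u (k j))

/-- The recursion of divided differences under the pairing. As no other index is `i`, the exchange
of `u i` and `u (i + 1)` affects the variable `j` only. -/
lemma pairing_newtonFun_exchange (M : ℕ) (u : ℕ → K) (A : MvPolynomial (Fin ℓ) ℤ)
    {k : Fin ℓ → ℕ} {j : Fin ℓ} {i : ℕ} (hj : k j = i + 1) (hk : ∀ j', j' ≠ j → k j' ≠ i) :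
    pairing M (newtonFun u (Function.update k j i)) A -
      pairing M (newtonFun (u ∘ Equiv.swap i (i + 1)) (Function.update k j i)) A =
      (u i - u (i + 1)) * pairing M (newtonFun u k) A := by
  simp only [pairing_eq_sum, Finset.mul_sum, ← Finset.sum_sub_distrib]
  refine Finset.sum_congr rfl fun α _ => ?_
  rw [← smul_sub, mul_smul_comm]
  congr 1
  have h1 : ∀ j' ∈ Finset.univ.erase j, newtonFun (u ∘ Equiv.swap i (i + 1))
      (Function.update k j i) j' (M - α j') = newtonFun u k j' (M - α j') := fun j' hj' => by
    have := Finset.ne_of_mem_erase hj'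
    rw [newtonFun, newtonFun, Function.update_of_ne this, newton_swap_of_ne u (hk j' this)]
  have h2 : ∀ j' ∈ Finset.univ.erase j, newtonFun u
      (Function.update k j i) j' (M - α j') = newtonFun u k j' (M - α j') := fun j' hj' => by
    rw [newtonFun, newtonFun, Function.update_of_ne (Finset.ne_of_mem_erase hj')]
  rw [← Finset.mul_prod_erase _ _ (Finset.mem_univ j), ← Finset.mul_prod_erase _ _
    (Finset.mem_univ j), ← Finset.mul_prod_erase _ _ (Finset.mem_univ j),
    Finset.prod_congr rfl h1, Finset.prod_congr rfl h2, ← sub_mul, ← mul_assoc]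
  congr 1
  have := congrArg (PowerSeries.coeff (M - α j)) (newton_sub_newton_swap u i)
  rw [map_sub, PowerSeries.coeff_C_mul] at this
  simpa [newtonFun, hj] using this

/-- A divided difference at `k j + 1` points kills the powers below `k j` and sends that with
exponent `k j` to `1`. So in the right degree it extracts one coefficient. -/
lemma pairing_newtonFun_eq_coeff {M d : ℕ} (u : ℕ → K) {A : MvPolynomial (Fin ℓ) ℤ}
    (hA : A.IsHomogeneous d) (hdeg : ∀ α ∈ A.support, ∀ j, α j ≤ M) {k n : Fin ℓ → ℕ}
    (hkn : ∀ j, k j + n j = M) (hd : ∑ j, n j = d) :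
    pairing M (newtonFun u k) A = coeff (expo n) A := by
  rw [pairing_eq_sum, Finset.sum_eq_single (expo n)]
  · rw [zsmul_eq_mul, Finset.prod_eq_one, mul_one]
    intro j _
    have : M - n j = k j := by have := hkn j; omega
    rw [newtonFun, Finsupp.equivFunOnFinite_symm_apply_apply, this, coeff_newton_self]
  · intro α hα hne
    have hsum : ∑ j, α j = ∑ j, n j :=
      (sum_eq_of_coeff_ne_zero hA (mem_support_iff.1 hα)).trans hd.symm
    obtain ⟨j, hj⟩ : ∃ j, n j < α j := by
      by_contra! hle
      apply hne
      ext j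
      exact (Finset.sum_eq_sum_iff_of_le fun i _ => hle i).1 hsum j (Finset.mem_univ j)
    rw [Finset.prod_eq_zero (Finset.mem_univ j), smul_zero]
    refine coeff_newton_of_lt _ ?_
    have := hkn j
    have := hdeg α hα j
    omega
  · intro h
    rw [notMem_support_iff.1 h, zero_smul]

/-- The Vandermonde determinant at the inverses. -/
lemma det_pow_inv {x : ℕ → K} (hx : ∀ i < ℓ, x i ≠ 0) :
    (∏ j : Fin ℓ, x j ^ (ℓ - 1)) * (Matrix.of fun i j : Fin ℓ => (x j)⁻¹ ^ (i : ℕ)).det =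
      (Equiv.Perm.sign (Fin.revPerm (n := ℓ)) : ℤ) *
        (Matrix.of fun i j : Fin ℓ => x j ^ (i : ℕ)).det := by
  rw [← Matrix.det_mul_row, ← Matrix.det_permute]
  congr 1
  ext1 i j
  simp only [Matrix.of_apply, Matrix.submatrix_apply, id, Fin.revPerm_apply, Fin.val_rev]
  rw [inv_pow, ← div_eq_mul_inv, div_eq_iff (pow_ne_zero _ (hx j j.2)), ← pow_add]
  congr 1
  omega

/-- A polynomial at `x` is a combination of divided differences in the inverse variables. -/
lemma aeval_eq_pairing [CharZero K] {M : ℕ} {A : MvPolynomial (Fin ℓ) ℤ} (hA : IsAntisymmetric A)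
    (hdeg : ∀ α ∈ A.support, ∀ j, α j ≤ M) {x : ℕ → K} (hx : ∀ i < ℓ, x i ≠ 0) :
    aeval (fun j : Fin ℓ => x j) A = (∏ j : Fin ℓ, x j ^ M) *
      ((Matrix.of fun i j : Fin ℓ => (x j)⁻¹ ^ (i : ℕ)).det *
        pairing M (newtonFun (fun i => (x i)⁻¹) fun j => (j : ℕ)) A) := by
  set u : ℕ → K := fun i => (x i)⁻¹ with hu
  rw [show (Matrix.of fun i j : Fin ℓ => (x j)⁻¹ ^ (i : ℕ)).det =
    (Matrix.of fun k j : Fin ℓ => newtonBasis u k j).det from (det_newtonBasis u ℓ).symm,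
    ← pairing_sum_mul hA, pairing_eq_sum]
  conv_lhs => rw [A.as_sum]
  rw [map_sum, Finset.mul_sum]
  refine Finset.sum_congr rfl fun α hα => ?_
  rw [aeval_monomial, mul_smul_comm, zsmul_eq_mul, ← Finset.prod_mul_distrib,
    Finsupp.prod_fintype _ _ (by simp)]
  congr 1
  refine Finset.prod_congr rfl fun j _ => ?_
  have h1 : ∑ k : Fin ℓ, (Matrix.of fun k j : Fin ℓ => newtonBasis u k j) k j *
      newtonFun u (fun j : Fin ℓ => (j : ℕ)) k (M - α j) = u j ^ (M - α j) := by
    rw [← coeff_geo, geo_eq_sum_newton u j.2, map_sum]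
    refine Finset.sum_congr rfl fun k _ => ?_
    rw [PowerSeries.coeff_C_mul]
    rfl
  rw [h1, hu, inv_pow, ← div_eq_mul_inv, eq_div_iff (pow_ne_zero _ (hx j j.2)), ← pow_add,
    Nat.add_sub_cancel' (hdeg α hα j)]

end FermionBoson

/-! ### Matrix elements as divided differences -/

namespace FermionBoson

open MvPolynomial

section Operators

variable {R : Type*} [CommRing R]

/-- The product of the first `n` row transfer matrices, of type `∘` at the positions in `S` and of
type `•` at the others. -/
def transferProd (N : ℕ) (S : Finset ℕ) (x : ℕ → R) : ℕ → Module.End R (Fock R)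
  | 0 => 1
  | n + 1 => transferProd N S x n * monodromy (x n) N (if n ∈ S then 0 else 2) 0

lemma transferProd_congr (N : ℕ) {S S' : Finset ℕ} {x x' : ℕ → R} {n : ℕ}
    (hS : ∀ i < n, i ∈ S ↔ i ∈ S') (hx : ∀ i < n, x i = x' i) :
    transferProd N S x n = transferProd N S' x' n := by
  induction n with
  | zero => rfl
  | succ n ih =>
    rw [transferProd, transferProd, ih (fun i hi => hS i (by omega)) fun i hi => hx i (by omega),
      hx n (by omega)]
    simp only [hS n (by omega)]

lemma transferProd_eq_prod (N : ℕ) (S : Finset ℕ) (x : ℕ → R) (n : ℕ) :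
    transferProd N S x n = ((List.range n).map fun i =>
      monodromy (x i) N (if i ∈ S then 0 else 2) 0).prod := by
  induction n with
  | zero => rfl
  | succ n ih => rw [transferProd, ih, List.range_succ]; simp

/-- Moving a factor `∘` one step to the left across a factor `•`, with weights that make it a
divided difference in the inverses of `x i` and `x (i + 1)`. -/
lemma transferProd_exchange (N : ℕ) {S : Finset ℕ} (x : ℕ → R) {i n : ℕ} (hi : i ∉ S)
    (hi' : i + 1 ∈ S) (hn : i + 2 ≤ n) :
    (x (i + 1) - x i) • transferProd N S x n =
      x (i + 1) • transferProd N (insert i (S.erase (i + 1))) x n -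
        x i • transferProd N (insert i (S.erase (i + 1))) (x ∘ Equiv.swap i (i + 1)) n := by
  have hS : ∀ j, j ≠ i → j ≠ i + 1 → (j ∈ S ↔ j ∈ insert i (S.erase (i + 1))) := by
    intro j h1 h2; simp [h1, h2]
  have hsw : ∀ j, j ≠ i → j ≠ i + 1 → (x ∘ Equiv.swap i (i + 1)) j = x j := by
    intro j h1 h2
    rw [Function.comp_apply, Equiv.swap_apply_of_ne_of_ne h1 h2]
  induction n, hn using Nat.le_induction with
  | base =>
    simp only [transferProd]
    rw [← transferProd_congr N (n := i) (x := x) (x' := x) (fun j hj => hS j (by omega) (by omega))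
      (fun _ _ => rfl), ← transferProd_congr N (n := i) (x := x)
      (fun j hj => hS j (by omega) (by omega))
      (fun j hj => (hsw j (by omega) (by omega)).symm)]
    simp only [hi, hi', Finset.mem_insert, Finset.mem_erase, Function.comp_apply,
      Equiv.swap_apply_left, Equiv.swap_apply_right, if_true, if_false, true_or, ne_eq,
      not_true_eq_false, false_and, or_false, Nat.succ_ne_self, mul_assoc]
    refine LinearMap.ext fun v => ?_
    have := congrArg (transferProd N S x i)
      (LinearMap.congr_fun (monodromy_exchange (x i) (x (i + 1)) N) v)
    simpa only [LinearMap.sub_apply, LinearMap.smul_apply, Module.End.mul_apply, map_sub,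
      map_smul] using this
  | succ n hn ih =>
    simp only [transferProd]
    rw [hsw n (by omega) (by omega), ← smul_mul_assoc, ih]
    refine LinearMap.ext fun v => ?_
    simp only [LinearMap.sub_apply, LinearMap.smul_apply, Module.End.mul_apply,
      hS n (by omega) (by omega)]

lemma transferProd_mem_sector {N : ℕ} (S : Finset ℕ) (x : ℕ → R) (n : ℕ) {c : ℤ} {v : Fock R}
    (hv : v ∈ sector R N c) :
    transferProd N S x n v ∈ sector R N (c - ((Finset.range n).filter (· ∉ S)).card) := by
  induction n generalizing v c with
  | zero => simpa [transferProd] using hv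
  | succ n ih =>
    have h := ih (monodromy_mem_sector le_rfl (x n) (if n ∈ S then 0 else 2) 0 hv)
    have e : c + edgeCharge 0 - edgeCharge (if n ∈ S then 0 else 2) -
        ((Finset.range n).filter (· ∉ S)).card =
        c - ((Finset.range (n + 1)).filter (· ∉ S)).card := by
      rw [Finset.range_add_one, Finset.filter_insert]
      split_ifs with h
      · simp [edgeCharge]
      · rw [Finset.card_insert_of_notMem (by simp)]
        simp [edgeCharge]
        ring
    rw [e] at h
    exact h

/-- The fermions leave one by one through the factors `•` on the right. -/
lemma transferProd_range_ket {N ℓ r : ℕ} (hr : r ≤ N) (x : ℕ → R) (m : ℕ →₀ ℕ) :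
    transferProd N (Finset.range ℓ) x (ℓ + r) (ket R (Finset.Ico (N - r) N, m)) =
      (∏ t ∈ Finset.range r, x (ℓ + t) ^ (N - 1 - t)) •
        transferProd N (Finset.range ℓ) x ℓ (ket R (∅, m)) := by
  induction r with
  | zero => simp
  | succ r ih =>
    rw [← add_assoc, transferProd, if_neg (by simp), Module.End.mul_apply,
      monodromy_two_ket_Ico _ (by omega : N - (r + 1) < N) le_rfl,
      show N - (r + 1) + 1 = N - r by omega, map_smul, ih (by omega), smul_smul,
      Finset.prod_range_succ, mul_comm, show N - 1 - r = N - (r + 1) by omega]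

end Operators

section Weights

variable {R : Type*} [CommRing R]

/-- The monomial `∏ x_i ^ p_i`, where `p_i` is the number of positions `j > i` outside `S`, as a
product over these positions. -/
def rowWeight (S : Finset ℕ) (x : ℕ → R) (n : ℕ) : R :=
  ∏ j ∈ Finset.range n \ S, ∏ i ∈ Finset.range j, x i

lemma prod_range_swap (x : ℕ → R) {i j : ℕ} (h : j ≠ i + 1) :
    ∏ t ∈ Finset.range j, (x ∘ Equiv.swap i (i + 1)) t = ∏ t ∈ Finset.range j, x t := by
  refine Finset.prod_equiv (Equiv.swap i (i + 1)) (fun t => ?_) fun t _ => rfl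
  simp only [Finset.mem_range]
  rcases eq_or_ne t i with rfl | h1
  · simp; omega
  · rcases eq_or_ne t (i + 1) with rfl | h2
    · simp; omega
    · rw [Equiv.swap_apply_of_ne_of_ne h1 h2]

lemma rowWeight_exchange {S : Finset ℕ} (x : ℕ → R) {i n : ℕ} (hi : i ∉ S) (hi' : i + 1 ∈ S)
    (hn : i + 2 ≤ n) :
    rowWeight (insert i (S.erase (i + 1))) x n = x i * rowWeight S x n ∧
      rowWeight (insert i (S.erase (i + 1))) (x ∘ Equiv.swap i (i + 1)) n =
        x (i + 1) * rowWeight S x n := by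
  set T := (Finset.range n \ S).erase i with hT
  have h1 : Finset.range n \ S = insert i T := by
    rw [hT, Finset.insert_erase]
    simp [hi]; omega
  have h2 : Finset.range n \ insert i (S.erase (i + 1)) = insert (i + 1) T := by
    ext j
    simp only [hT, Finset.mem_sdiff, Finset.mem_insert, Finset.mem_erase, Finset.mem_range]
    by_cases e1 : j = i
    · simp [e1]
    · by_cases e2 : j = i + 1
      · simp [e2]; omega
      · simp [e1, e2]
  have h3 : i ∉ T := by simp [hT]
  have h4 : i + 1 ∉ T := by simp [hT, hi']
  have h5 : ∏ j ∈ T, ∏ t ∈ Finset.range j, (x ∘ Equiv.swap i (i + 1)) t =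
      ∏ j ∈ T, ∏ t ∈ Finset.range j, x t :=
    Finset.prod_congr rfl fun j hj => prod_range_swap x fun e => h4 (e ▸ hj)
  rw [rowWeight, rowWeight, rowWeight, h1, h2, Finset.prod_insert h3, Finset.prod_insert h4,
    Finset.prod_insert h4, h5, Finset.prod_range_succ, Finset.prod_range_succ,
    prod_range_swap x (by omega : i ≠ i + 1), Function.comp_apply, Equiv.swap_apply_left]
  constructor <;> ring

lemma prod_prod_range (y : ℕ → R) (N : ℕ) :
    ∏ j ∈ Finset.range N, ∏ t ∈ Finset.range j, y t =
      ∏ t ∈ Finset.range N, y t ^ (N - 1 - t) := by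
  induction N with
  | zero => simp
  | succ N ih =>
    rw [Finset.prod_range_succ, ih, ← Finset.prod_mul_distrib, Finset.prod_range_succ,
      Nat.add_sub_cancel, Nat.sub_self, pow_zero, mul_one]
    refine Finset.prod_congr rfl fun t ht => ?_
    have := Finset.mem_range.1 ht
    rw [← pow_succ]
    congr 1
    omega

lemma rowWeight_range (ℓ N : ℕ) (x : ℕ → R) :
    rowWeight (Finset.range ℓ) x (ℓ + N) =
      (∏ i ∈ Finset.range ℓ, x i) ^ N * ∏ t ∈ Finset.range N, x (ℓ + t) ^ (N - 1 - t) := by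
  rw [rowWeight, Finset.range_eq_Ico, Finset.range_eq_Ico]
  have h : Finset.Ico 0 (ℓ + N) \ Finset.Ico 0 ℓ = Finset.Ico ℓ (ℓ + N) := by
    ext j; simp only [Finset.mem_sdiff, Finset.mem_Ico]; omega
  rw [h, Finset.prod_Ico_eq_prod_range, Nat.add_sub_cancel_left, ← Finset.range_eq_Ico]
  simp only [Finset.prod_range_add]
  rw [Finset.prod_mul_distrib, Finset.prod_const, Finset.card_range,
    prod_prod_range (fun t => x (ℓ + t))]

end Weights

lemma map_det_geo {R S : Type*} [CommRing R] [CommRing S] (f : R →+* S) {ℓ : ℕ} (q l : Fin ℓ → ℕ)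
    (x : Fin ℓ → R) :
    f (Matrix.of fun i j => PowerSeries.coeff (l i) (PowerSeries.X ^ q j * ∏ k, geo (x k))).det =
      (Matrix.of fun i j =>
        PowerSeries.coeff (l i) (PowerSeries.X ^ q j * ∏ k, geo (f (x k)))).det := by
  have h : ∏ k, geo (f (x k)) = PowerSeries.map f (∏ k, geo (x k)) := by
    rw [map_prod]
    refine Finset.prod_congr rfl fun k _ => ?_
    ext n
    rw [PowerSeries.coeff_map, coeff_geo, coeff_geo, map_pow]
  rw [RingHom.map_det, h]
  congr 1
  ext1 i j
  simp only [RingHom.mapMatrix_apply, Matrix.map_apply, Matrix.of_apply,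
    PowerSeries.coeff_X_pow_mul']
  split_ifs
  · rw [PowerSeries.coeff_map]
  · exact map_zero f

lemma aeval_skew {K : Type*} [CommRing K] {ℓ : ℕ} (q l : Fin ℓ → ℕ) (x : Fin ℓ → K) :
    aeval x (skew q l) = (Matrix.of fun i j =>
      PowerSeries.coeff (l i) (PowerSeries.X ^ q j * ∏ k, geo (x k))).det := by
  rw [skew, completeSeries_eq_prod]
  have := map_det_geo (aeval x : MvPolynomial (Fin ℓ) ℤ →ₐ[ℤ] K).toRingHom q l X
  simpa using this

lemma aeval_alt {K : Type*} [CommRing K] {ℓ : ℕ} (γ : Fin ℓ → ℕ) (x : Fin ℓ → K) :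
    aeval x (alt γ) = (Matrix.of fun i j => x j ^ γ i).det := by
  rw [alt, AlgHom.map_det]
  congr 1
  ext1 i j
  simp

section Main

variable {R : Type*} [CommRing R] {K : Type*} [Field K] [Algebra R K]

/-- The matrix element `⟨0| ⊗ ⟨μ| ⋯ |1⟩ ⊗ |λ⟩` of a product of transfer matrices. -/
def matrixElement {ℓ : ℕ} (N : ℕ) (lam mu : Fin ℓ → ℕ) (S : Finset ℕ) (x : ℕ → R) (n : ℕ) : R :=
  transferProd N S x n (ket R (Finset.range N, bosonState lam)) (∅, bosonState mu)

/-- If all factors `∘` stand on the left, the fermions are removed first, and a skew Schur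
polynomial in the first `ℓ` variables remains. -/
lemma matrixElement_range {ℓ N : ℕ} {lam mu : Fin ℓ → ℕ} (hlam : Antitone lam) (hmu : Antitone mu)
    (hlamN : ∀ i, lam i < N) (hmuN : ∀ i, mu i < N) (x : ℕ → R) :
    algebraMap R K (matrixElement N lam mu (Finset.range ℓ) x (ℓ + N)) =
      (∏ t ∈ Finset.range N, algebraMap R K (x (ℓ + t)) ^ (N - 1 - t)) *
        aeval (fun j : Fin ℓ => algebraMap R K (x j)) (skew (betaSeq mu) (betaSeq lam)) := by
  have h1 := transferProd_range_ket (ℓ := ℓ) (le_refl N) x (bosonState lam)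
  rw [Nat.sub_self, ← Finset.range_eq_Ico] at h1
  have h2 : transferProd N (Finset.range ℓ) x ℓ =
      (((List.ofFn fun i : Fin ℓ => x i)).map fun x => monodromy x N 0 0).prod := by
    rw [transferProd_eq_prod, List.map_ofFn, List.ofFn_eq_map, ← List.map_coe_finRange_eq_range,
      List.map_map]
    congr 1
    refine List.map_congr_left fun i _ => ?_
    simp
  rw [matrixElement, h1, Finsupp.smul_apply, smul_eq_mul, map_mul, map_prod, h2,
    prod_monodromy_apply_eq_det hlam hmu hlamN hmuN, aeval_skew, List.map_ofFn, List.prod_ofFn]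
  congr 1
  · simp
  · exact map_det_geo (algebraMap R K) _ _ _

/-- The matrix elements are divided differences in the inverse variables of an antisymmetric
polynomial that does not depend on the positions `k` of the factors `∘`: both sides obey the same
exchange relation and agree if these factors stand on the left. -/
theorem matrixElement_eq_pairing [CharZero K] {ℓ N M : ℕ} (hM : M = ℓ - 1 + N)
    {lam mu : Fin ℓ → ℕ}
    (hlam : Antitone lam) (hmu : Antitone mu) (hlamN : ∀ i, lam i < N) (hmuN : ∀ i, mu i < N)
    (k : Fin ℓ → ℕ) (hk : StrictMono k) (hkn : ∀ j, k j < ℓ + N) (x : ℕ → R)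
    (hx : ∀ i < ℓ + N, algebraMap R K (x i) ≠ 0)
    (hinj : ∀ i < ℓ + N, ∀ j < ℓ + N, algebraMap R K (x i) = algebraMap R K (x j) → i = j) :
    algebraMap R K (matrixElement N lam mu (Finset.univ.image k) x (ℓ + N)) =
      algebraMap R K (rowWeight (Finset.univ.image k) x (ℓ + N)) *
        ((Equiv.Perm.sign (Fin.revPerm (n := ℓ)) : ℤ) *
          pairing M (newtonFun (fun i => (algebraMap R K (x i))⁻¹) k)
            (alt (fun j : Fin ℓ => (j : ℕ)) * skew (betaSeq mu) (betaSeq lam))) := by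
  set A : MvPolynomial (Fin ℓ) ℤ :=
    alt (fun j : Fin ℓ => (j : ℕ)) * skew (betaSeq mu) (betaSeq lam) with hA
  have hanti : IsAntisymmetric A := (isAntisymmetric_alt _).mul_skew _ _
  have hdeg : ∀ α ∈ A.support, ∀ j, α j ≤ M := fun α hα j =>
    hM ▸ apply_le_of_mem_support hlam hmu hlamN hmuN hα j
  induction hs : ∑ j, k j using Nat.strong_induction_on generalizing k x with
  | _ s ih =>
  by_cases hid : ∀ j, k j = j
  · -- All factors `∘` stand on the left.
    have hS : Finset.univ.image k = Finset.range ℓ := by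
      ext i
      simp only [Finset.mem_image, Finset.mem_univ, true_and, hid, Finset.mem_range]
      exact ⟨fun ⟨j, hj⟩ => hj ▸ j.2, fun h => ⟨⟨i, h⟩, rfl⟩⟩
    have hkid : k = fun j : Fin ℓ => (j : ℕ) := funext hid
    set y : ℕ → K := fun i => algebraMap R K (x i) with hy
    have hy0 : ∀ i < ℓ, y i ≠ 0 := fun i hi => hx i (by omega)
    set V := (Matrix.of fun i j : Fin ℓ => y j ^ (i : ℕ)).det with hV
    set D := pairing M (newtonFun (fun i => (y i)⁻¹) fun j : Fin ℓ => (j : ℕ)) A with hD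
    set F := aeval (fun j : Fin ℓ => y j) (skew (betaSeq mu) (betaSeq lam)) with hF
    set sg : K := (((Equiv.Perm.sign (Fin.revPerm (n := ℓ)) : ℤˣ) : ℤ) : K) with hsg
    have hV0 : V ≠ 0 := by
      have : V = (Matrix.vandermonde fun j : Fin ℓ => y j).det := by
        rw [← Matrix.det_transpose]
        rfl
      rw [this, Matrix.det_vandermonde_ne_zero_iff]
      intro i j hij
      exact Fin.ext (hinj i (by omega) j (by omega) hij)
    have h1 : V * F = (∏ j : Fin ℓ, y j ^ M) *
        ((Matrix.of fun i j : Fin ℓ => (y j)⁻¹ ^ (i : ℕ)).det * D) := by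
      rw [← aeval_eq_pairing hanti hdeg hy0, hA, map_mul, aeval_alt]
    have h2 : (∏ j : Fin ℓ, y j ^ M) =
        (∏ j : Fin ℓ, y j ^ N) * ∏ j : Fin ℓ, y j ^ (ℓ - 1) := by
      rw [← Finset.prod_mul_distrib]
      refine Finset.prod_congr rfl fun j _ => ?_
      rw [← pow_add, hM, add_comm]
    have h3 : F = (∏ j : Fin ℓ, y j ^ N) * (sg * D) := by
      apply mul_left_cancel₀ hV0
      rw [h1, h2, mul_assoc, ← mul_assoc (∏ j : Fin ℓ, y j ^ (ℓ - 1)), det_pow_inv hy0]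
      ring
    rw [hS, hkid, matrixElement_range hlam hmu hlamN hmuN, rowWeight_range]
    change _ * F = _
    rw [h3, map_mul, map_pow, map_prod, map_prod, Finset.prod_pow,
      Fin.prod_univ_eq_prod_range (fun j => y j)]
    simp only [map_pow]
    change _ = (∏ i ∈ Finset.range ℓ, y i) ^ N *
      (∏ t ∈ Finset.range N, y (ℓ + t) ^ (N - 1 - t)) * (sg * D)
    ring
  · -- The first `∘` that is not in its leftmost place moves one step to the left.
    push Not at hid
    obtain ⟨j, hj, hmin⟩ : ∃ j, k j ≠ j ∧ ∀ j' < j, k j' = j' := by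
      obtain ⟨j, hj, hmin⟩ := WellFounded.has_min (wellFounded_lt (α := Fin ℓ)) {j | k j ≠ j} hid
      exact ⟨j, hj, fun j' h => not_not.1 fun h' => hmin j' h' h⟩
    have hjk : (j : ℕ) < k j := by
      have := SchurFunction.strictMono_add_le hk ⟨0, j.pos⟩ j (by simp)
      simp only [zero_add, Fin.eta] at this
      omega
    obtain ⟨i, hi⟩ : ∃ i, k j = i + 1 := ⟨k j - 1, by omega⟩
    have hne : ∀ j', k j' ≠ i := by
      intro j' e
      have h1 : j' < j := hk.lt_iff_lt.1 (by omega)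
      have := hmin j' h1
      have : (j' : ℕ) < j := h1
      omega
    set S := Finset.univ.image k with hS
    have hiS : i ∉ S := by
      rw [hS, Finset.mem_image]
      rintro ⟨j', -, e⟩
      exact hne j' e
    have hiS' : i + 1 ∈ S := hi ▸ Finset.mem_image_of_mem k (Finset.mem_univ j)
    have hin : i + 2 ≤ ℓ + N := by have := hkn j; omega
    set k' := Function.update k j i with hk'
    have hk'j : k' j = i := Function.update_self _ _ _
    have hk'ne : ∀ j', j' ≠ j → k' j' = k j' := fun j' h => Function.update_of_ne h _ _
    have hk'mono : StrictMono k' := by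
      intro a b hab
      rcases eq_or_ne a j with rfl | ha
      · rw [hk'j, hk'ne b hab.ne']
        have := hk hab
        omega
      · rcases eq_or_ne b j with rfl | hb
        · rw [hk'j, hk'ne a ha]
          have := hk hab
          have := hne a
          omega
        · rw [hk'ne a ha, hk'ne b hb]
          exact hk hab
    have hk'n : ∀ j', k' j' < ℓ + N := by
      intro j'
      rcases eq_or_ne j' j with rfl | h
      · rw [hk'j]; omega
      · rw [hk'ne j' h]; exact hkn j'
    have hS' : Finset.univ.image k' = insert i (S.erase (i + 1)) := by
      ext t
      simp only [Finset.mem_image, Finset.mem_univ, true_and, Finset.mem_insert, Finset.mem_erase,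
        hS]
      constructor
      · rintro ⟨j', rfl⟩
        rcases eq_or_ne j' j with rfl | h
        · exact Or.inl hk'j
        · rw [hk'ne j' h]
          exact Or.inr ⟨fun e => h (hk.injective (e.trans hi.symm)), j', rfl⟩
      · rintro (rfl | ⟨h, j', rfl⟩)
        · exact ⟨j, hk'j⟩
        · refine ⟨j', hk'ne j' ?_⟩
          rintro rfl
          exact h hi
    have hsum : ∑ j', k' j' < s := by
      rw [← hs]
      refine Finset.sum_lt_sum (fun j' _ => ?_) ⟨j, Finset.mem_univ j, by rw [hk'j]; omega⟩
      rcases eq_or_ne j' j with rfl | h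
      · rw [hk'j]; omega
      · rw [hk'ne j' h]
    have hswlt : ∀ t < ℓ + N, Equiv.swap i (i + 1) t < ℓ + N := by
      intro t ht
      rw [Equiv.swap_apply_def]
      split_ifs <;> omega
    have ih1 := ih _ hsum k' hk'mono hk'n x hx hinj rfl
    have ih2 := ih _ hsum k' hk'mono hk'n (x ∘ Equiv.swap i (i + 1))
      (fun t ht => hx _ (hswlt t ht))
      (fun t ht t' ht' e => (Equiv.swap i (i + 1)).injective
        (hinj _ (hswlt t ht) _ (hswlt t' ht') e)) rfl
    obtain ⟨w1, w2⟩ := rowWeight_exchange (R := R) x hiS hiS' hin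
    rw [hS', w1] at ih1
    rw [hS', w2] at ih2
    have hex : (x (i + 1) - x i) * matrixElement N lam mu S x (ℓ + N) =
        x (i + 1) * matrixElement N lam mu (insert i (S.erase (i + 1))) x (ℓ + N) -
          x i * matrixElement N lam mu (insert i (S.erase (i + 1)))
            (x ∘ Equiv.swap i (i + 1)) (ℓ + N) := by
      have := congrArg (fun T : Module.End R (Fock R) =>
        T (ket R (Finset.range N, bosonState lam)) (∅, bosonState mu))
        (transferProd_exchange N x hiS hiS' hin)
      simpa [matrixElement] using this
    have hpair := pairing_newtonFun_exchange M (fun i => (algebraMap R K (x i))⁻¹) A hi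
      fun j' _ => hne j'
    have hfun : (fun t => (algebraMap R K ((x ∘ Equiv.swap i (i + 1)) t))⁻¹) =
        (fun t => (algebraMap R K (x t))⁻¹) ∘ Equiv.swap i (i + 1) := rfl
    rw [hfun] at ih2
    have hex' := congrArg (algebraMap R K) hex
    simp only [map_mul, map_sub] at hex' ih1 ih2
    rw [ih1, ih2] at hex'
    set a := algebraMap R K (x i) with ha
    set b := algebraMap R K (x (i + 1)) with hb
    have ha0 : a ≠ 0 := hx i (by omega)
    have hb0 : b ≠ 0 := hx (i + 1) (by omega)
    have hab : b - a ≠ 0 := sub_ne_zero.2 fun e => by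
      have := hinj (i + 1) (by omega) i (by omega) e
      omega
    have hinv : a * b * (a⁻¹ - b⁻¹) = b - a := by field_simp
    apply mul_left_cancel₀ hab
    rw [hex', ← hinv]
    rw [← hk'] at hpair
    linear_combination (b * a * algebraMap R K (rowWeight S x (ℓ + N)) *
      (((Equiv.Perm.sign (Fin.revPerm (n := ℓ)) : ℤˣ) : ℤ) : K)) * hpair

end Main

end FermionBoson

/-! ### Evaluation of the partition function -/

namespace FermionBoson

open MvPolynomial

lemma apply_eq_zero_of_mem_sector {R : Type*} [CommRing R] {N : ℕ} {c : ℤ} {v : Fock R}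
    (hv : v ∈ sector R N c) {s : Config} (hs : width s ≤ N → (s.1.card : ℤ) ≠ c) : v s = 0 := by
  by_contra h
  have := (Finsupp.mem_supported R v).1 hv (Finsupp.mem_support_iff.2 h)
  exact hs this.1 this.2

lemma prod_rowOp_apply {R : Type*} [CommRing R] {N : ℕ} (S : Finset ℕ) (x : ℕ → R) (n : ℕ) {c : ℤ}
    {v : Fock R} (hv : v ∈ sector R N c) :
    ((List.range n).map fun i => rowOp (if i ∈ S then 0 else 2) (x i)).prod v =
      transferProd N S x n v := by
  induction n generalizing v c with
  | zero => rfl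
  | succ n ih =>
    rw [List.range_succ, List.map_append, List.prod_append, Module.End.mul_apply, transferProd,
      Module.End.mul_apply, ← ih (monodromy_mem_sector le_rfl _ _ _ hv)]
    simp [rowOp_eq_monodromy _ _ hv]

/-- The positions of the factors `T*_∘`, counted from `0`. -/
def circlePositions {ℓ : ℕ} (L : ℕ) (nu : Fin ℓ → ℕ) : Finset ℕ :=
  (Finset.range (ℓ + L + 1)).filter fun i => (i : ℤ) + 1 ∈ kappa L nu

lemma mem_circlePositions {ℓ L : ℕ} {nu : Fin ℓ → ℕ} (i : Fin (ℓ + L + 1)) :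
    (i : ℕ) ∈ circlePositions L nu ↔ (i : ℤ) + 1 ∈ kappa L nu := by
  rw [circlePositions, Finset.mem_filter, Finset.mem_range]
  exact and_iff_right i.2

lemma initial_mem_sector {R : Type*} [CommRing R] {ℓ N : ℕ} {lam : Fin ℓ → ℕ}
    (h : ∀ i, lam i < N) : ket R (Finset.range N, bosonState lam) ∈ sector R N N :=
  ket_mem_sector (by simp) (fun i hi => lt_of_bosonState_ne_zero h hi) (by simp)

lemma partitionFunction_eq_matrixElement {ℓ L : ℕ} {lam : Fin ℓ → ℕ} (mu nu : Fin ℓ → ℕ)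
    (h : ∀ i, lam i < L + 1) :
    partitionFunction L lam mu nu = matrixElement (L + 1) lam mu (circlePositions L nu)
      (varSeq (ℓ + L + 1)) (ℓ + (L + 1)) := by
  rw [partitionFunction, matrixElement, ← prod_rowOp_apply _ _ _ (initial_mem_sector h),
    List.ofFn_eq_map, ← add_assoc, ← List.map_coe_finRange_eq_range, List.map_map]
  congr 4
  funext i
  simp only [Function.comp_apply, varSeq_coe, mem_circlePositions]

lemma rowWeight_circlePositions {ℓ : ℕ} (L : ℕ) (nu : Fin ℓ → ℕ) :
    rowWeight (circlePositions L nu) (varSeq (ℓ + L + 1)) (ℓ + (L + 1)) =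
      monomial (Finsupp.equivFunOnFinite.symm (exponent L nu)) 1 := by
  set S := circlePositions L nu with hS
  have h1 : rowWeight S (varSeq (ℓ + L + 1)) (ℓ + (L + 1)) =
      ∏ i ∈ Finset.range (ℓ + L + 1), ∏ _j ∈ (Finset.range (ℓ + L + 1)).filter
        (fun j => i < j ∧ j ∉ S), varSeq (ℓ + L + 1) i := by
    refine Finset.prod_comm' fun j i => ?_
    simp only [Finset.mem_sdiff, Finset.mem_range, Finset.mem_filter]
    constructor
    · rintro ⟨⟨h1, h2⟩, h3⟩; exact ⟨⟨by omega, h3, h2⟩, by omega⟩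
    · rintro ⟨⟨h1, h2, h3⟩, h4⟩; exact ⟨⟨by omega, h3⟩, h2⟩
  rw [h1, monomial_eq, C_1, one_mul, Finsupp.prod_fintype _ _ (by simp), Finset.prod_range]
  refine Finset.prod_congr rfl fun i _ => ?_
  rw [Finset.prod_const, varSeq_coe, Finsupp.equivFunOnFinite_symm_apply_apply, exponent]
  congr 1
  symm
  refine Finset.card_bij (fun j _ => (j : ℕ)) (fun j hj => ?_) (fun _ _ _ _ => Fin.ext)
    fun j hj => ?_
  · simp only [Finset.mem_filter, Finset.mem_univ, true_and] at hj
    simp only [Finset.mem_filter, Finset.mem_range, hS, mem_circlePositions]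
    exact ⟨j.2, hj⟩
  · rw [Finset.mem_filter, Finset.mem_range] at hj
    refine ⟨⟨j, hj.1⟩, ?_, rfl⟩
    simp only [Finset.mem_filter, Finset.mem_univ, true_and]
    have h2 := mem_circlePositions (nu := nu) ⟨j, hj.1⟩
    exact ⟨hj.2.1, fun h => hj.2.2 (h2.2 h)⟩

/-- If `ν` has a part that is too large, fewer than `ℓ` of the positions are in `κ`. -/
lemma card_circlePositions_lt {ℓ L : ℕ} {nu : Fin ℓ → ℕ} (i₀ : Fin ℓ)
    (h : (i₀ : ℕ) + L + 2 ≤ nu i₀) : (circlePositions L nu).card < ℓ := by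
  have hsub : circlePositions L nu ⊆
      (Finset.univ.erase i₀).image fun j : Fin ℓ => j + L + 1 - nu j := by
    intro i hi
    rw [circlePositions, Finset.mem_filter, kappa, Finset.mem_image] at hi
    obtain ⟨-, j, -, hj⟩ := hi
    rw [Finset.mem_image]
    refine ⟨j, ?_, by omega⟩
    rw [Finset.mem_erase]
    refine ⟨?_, Finset.mem_univ _⟩
    rintro rfl
    omega
  have h1 := (Finset.card_le_card hsub).trans Finset.card_image_le
  rw [Finset.card_erase_of_mem (Finset.mem_univ _), Finset.card_univ, Fintype.card_fin] at h1
  have := i₀.pos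
  omega

lemma circlePositions_eq_image {ℓ L : ℕ} {nu : Fin ℓ → ℕ} (h : ∀ j, nu j ≤ j + L + 1) :
    circlePositions L nu = Finset.univ.image fun j : Fin ℓ => j + L + 1 - nu j := by
  ext i
  simp only [circlePositions, kappa, Finset.mem_filter, Finset.mem_range, Finset.mem_image,
    Finset.mem_univ, true_and]
  constructor
  · rintro ⟨-, j, hj⟩
    have := h j
    exact ⟨j, by omega⟩
  · rintro ⟨j, hj⟩
    have := h j
    have := j.2
    exact ⟨by omega, j, by omega⟩

/-- The Jacobi–Trudi determinant vanishes if the inner partition is wider than the outer one. -/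
lemma skew_betaSeq_eq_zero {ℓ N : ℕ} {lam mu : Fin ℓ → ℕ} (hmu : Antitone mu)
    (hlamN : ∀ i, lam i < N) {i₀ : Fin ℓ} (h : N ≤ mu i₀) :
    skew (betaSeq mu) (betaSeq lam) = 0 := by
  have h0 : i₀.rev ≤ Fin.rev ⟨0, i₀.pos⟩ := Fin.rev_le_rev.2 (Nat.zero_le _)
  refine Matrix.det_eq_zero_of_column_eq_zero (Fin.rev ⟨0, i₀.pos⟩) fun i => ?_
  rw [Matrix.of_apply, PowerSeries.coeff_X_pow_mul', if_neg]
  have h1 : mu i₀ ≤ mu ⟨0, i₀.pos⟩ := hmu (Nat.zero_le _)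
  have h2 := hlamN i.rev
  have h3 := i.2
  simp only [betaSeq, Fin.rev_rev, Fin.val_rev]
  omega

/-- The partition function vanishes unless `μ` is confined to the first `N` sites. -/
lemma matrixElement_eq_zero_of_le {R : Type*} [CommRing R] {ℓ N : ℕ} {lam mu : Fin ℓ → ℕ}
    (hlamN : ∀ i, lam i < N) {i₀ : Fin ℓ} (h : N ≤ mu i₀) (S : Finset ℕ) (x : ℕ → R) (n : ℕ) :
    matrixElement N lam mu S x n = 0 := by
  refine apply_eq_zero_of_mem_sector (transferProd_mem_sector S x n (initial_mem_sector hlamN))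
    fun hw => ?_
  have h1 := (width_le_iff.1 hw).2 (mu i₀) (by
    rw [bosonState_apply, Finset.card_ne_zero]
    exact ⟨i₀, by simp⟩)
  omega

/-- The partition function vanishes unless exactly `N` factors `•` remove the `N` fermions. -/
lemma matrixElement_eq_zero_of_card_ne {R : Type*} [CommRing R] {ℓ N : ℕ} {lam mu : Fin ℓ → ℕ}
    (hlamN : ∀ i, lam i < N) {S : Finset ℕ} (x : ℕ → R) {n : ℕ}
    (h : ((Finset.range n).filter (· ∉ S)).card ≠ N) :
    matrixElement N lam mu S x n = 0 := by
  refine apply_eq_zero_of_mem_sector (transferProd_mem_sector S x n (initial_mem_sector hlamN))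
    fun _ => ?_
  simp only [Finset.card_empty]
  omega

/-- In the main case the divided difference has the degree at which it extracts the coefficient of
`x ^ betaSeq nu`; otherwise both sides vanish. -/
theorem partitionFunction_eq_monomial (ℓ L : ℕ) (lam mu nu : Fin ℓ → ℕ)
    (hlam : Antitone lam) (hmu : Antitone mu) (hnu : Antitone nu)
    (hL : IsGreatest (Set.range lam) L)
    (hsize : ∑ i, lam i = ∑ i, mu i + ∑ i, nu i) :
    partitionFunction L lam mu nu =
      monomial (Finsupp.equivFunOnFinite.symm (exponent L nu))
        (SchurFunction.lrCoeff (SchurFunction.diagram lam hlam)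
          (SchurFunction.diagram mu hmu) (SchurFunction.diagram nu hnu)) := by
  have hlamN : ∀ i, lam i < L + 1 := fun i => Nat.lt_succ_of_le (hL.2 ⟨i, rfl⟩)
  rw [partitionFunction_eq_matrixElement mu nu hlamN, SchurFunction.lrCoeff_diagram lam mu nu]
  by_cases hmuN : ∀ i, mu i < L + 1
  swap
  -- A part of `μ` exceeds all parts of `λ`.
  · push Not at hmuN
    obtain ⟨i₀, hi₀⟩ := hmuN
    rw [matrixElement_eq_zero_of_le hlamN hi₀, skew_betaSeq_eq_zero hmu hlamN hi₀]
    simp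
  set A : MvPolynomial (Fin ℓ) ℤ :=
    alt (fun j : Fin ℓ => (j : ℕ)) * skew (betaSeq mu) (betaSeq lam) with hA
  have hdeg : ∀ α ∈ A.support, ∀ j, α j ≤ ℓ - 1 + (L + 1) := fun α hα j =>
    apply_le_of_mem_support hlam hmu hlamN hmuN hα j
  by_cases hnuN : ∀ j, nu j ≤ j + L + 1
  swap
  -- An element of `κ` is not positive: too many factors `•`, and a coefficient beyond the degree.
  · push Not at hnuN
    obtain ⟨i₀, hi₀⟩ := hnuN
    have hS := card_circlePositions_lt (L := L) (nu := nu) i₀ (by omega)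
    rw [matrixElement_eq_zero_of_card_ne hlamN]
    · symm
      rw [monomial_eq_zero]
      by_contra hne
      have h1 := hdeg _ (mem_support_iff.2 hne) (Fin.rev i₀)
      rw [Finsupp.equivFunOnFinite_symm_apply_apply, betaSeq, Fin.rev_rev, Fin.val_rev] at h1
      omega
    · have h1 : (Finset.range (ℓ + (L + 1))).filter (· ∉ circlePositions L nu) =
          Finset.range (ℓ + (L + 1)) \ circlePositions L nu := by
        ext; simp
      have h2 := Finset.le_card_sdiff (circlePositions L nu) (Finset.range (ℓ + (L + 1)))
      rw [Finset.card_range] at h2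
      rw [h1]
      omega
  · set K := FractionRing (MvPolynomial (Fin (ℓ + L + 1)) ℤ)
    set k : Fin ℓ → ℕ := fun j => j + L + 1 - nu j with hk
    have hkmono : StrictMono k := by
      intro a b hab
      have h1 := hnuN a
      have h2 : nu b ≤ nu a := hnu hab.le
      have h3 : (a : ℕ) < b := hab
      simp only [hk]
      omega
    have hinj : Function.Injective (algebraMap (MvPolynomial (Fin (ℓ + L + 1)) ℤ) K) :=
      IsFractionRing.injective _ _
    have hvar : ∀ i (h : i < ℓ + (L + 1)), varSeq (ℓ + L + 1) i = X ⟨i, h⟩ := fun i h => dif_pos h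
    have hhom : A.IsHomogeneous (∑ i : Fin ℓ, (i : ℕ) + ∑ i, nu i) := by
      refine (isHomogeneous_alt _).mul (isHomogeneous_skew ?_)
      rw [SchurFunction.sum_betaSeq, SchurFunction.sum_betaSeq]
      omega
    have hpair : pairing (ℓ - 1 + (L + 1))
        (newtonFun (fun i => (algebraMap _ K (varSeq (ℓ + L + 1) i))⁻¹) k) A =
        ((coeff (expo (betaSeq nu ∘ Fin.revPerm)) A : ℤ) : K) := by
      refine pairing_newtonFun_eq_coeff _ hhom hdeg (fun j => ?_) ?_
      · have := hnuN j
        have := j.2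
        simp only [hk, Function.comp_apply, Fin.revPerm_apply, betaSeq, Fin.rev_rev, Fin.val_rev]
        omega
      · rw [Function.comp_def, Equiv.sum_comp Fin.revPerm, SchurFunction.sum_betaSeq, add_comm]
    apply hinj
    rw [circlePositions_eq_image hnuN, matrixElement_eq_pairing rfl hlam hmu hlamN hmuN k hkmono,
      ← circlePositions_eq_image hnuN, rowWeight_circlePositions, hpair,
      ((isAntisymmetric_alt _).mul_skew _ _).coeff_comp]
    · have hsign : ((Equiv.Perm.sign (Fin.revPerm (n := ℓ)) : ℤ) : K) *
          (Equiv.Perm.sign (Fin.revPerm (n := ℓ)) : ℤ) = 1 := by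
        rw [← Int.cast_mul, Int.units_coe_mul_self, Int.cast_one]
      have hmon (e : Fin (ℓ + L + 1) →₀ ℕ) (c : ℤ) :
          algebraMap (MvPolynomial (Fin (ℓ + L + 1)) ℤ) K (monomial e c) =
            algebraMap (MvPolynomial (Fin (ℓ + L + 1)) ℤ) K (monomial e 1) * (c : K) := by
        rw [← map_intCast (algebraMap (MvPolynomial (Fin (ℓ + L + 1)) ℤ) K), ← map_mul,
          ← zsmul_eq_mul', smul_monomial, smul_eq_mul, mul_one]
      rw [hmon _ (coeff (expo (betaSeq nu)) A), ← one_mul ((coeff (expo (betaSeq nu)) A : ℤ) : K),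
        ← hsign, Int.cast_mul, mul_assoc]
    · intro j
      have := j.2
      simp only [hk]
      omega
    · intro i hi
      rw [hvar i hi, Ne, map_eq_zero_iff _ hinj]
      exact X_ne_zero _
    · intro i hi j hj h
      have := hinj h
      rw [hvar i hi, hvar j hj] at this
      exact congrArg Fin.val (X_injective this)

end FermionBoson

end

theorem mainTheorem5 (ℓ L : ℕ) (lam mu nu : Fin ℓ → ℕ)
    (hlam : Antitone lam) (hmu : Antitone mu) (hnu : Antitone nu)
    (hL : IsGreatest (Set.range lam) L)
    (hsize : ∑ i, lam i = ∑ i, mu i + ∑ i, nu i) :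
    FermionBoson.partitionFunction L lam mu nu =
        MvPolynomial.monomial (Finsupp.equivFunOnFinite.symm (FermionBoson.exponent L nu))
          (SchurFunction.lrCoeff (SchurFunction.diagram lam hlam)
            (SchurFunction.diagram mu hmu) (SchurFunction.diagram nu hnu)) ∧
      (SchurFunction.lrCoeff (SchurFunction.diagram lam hlam)
          (SchurFunction.diagram mu hmu) (SchurFunction.diagram nu hnu) :
          FractionRing (MvPolynomial (Fin (ℓ + L + 1)) ℤ)) =
        (∏ i : Fin (ℓ + L + 1),
          (algebraMap (MvPolynomial (Fin (ℓ + L + 1)) ℤ)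
            (FractionRing (MvPolynomial (Fin (ℓ + L + 1)) ℤ))
            (MvPolynomial.X i))⁻¹ ^ FermionBoson.exponent L nu i) *
          algebraMap (MvPolynomial (Fin (ℓ + L + 1)) ℤ)
            (FractionRing (MvPolynomial (Fin (ℓ + L + 1)) ℤ))
            (FermionBoson.partitionFunction L lam mu nu) := by
  have h := FermionBoson.partitionFunction_eq_monomial ℓ L lam mu nu hlam hmu hnu hL hsize
  refine ⟨h, ?_⟩
  have hX : ∀ i : Fin (ℓ + L + 1), algebraMap (MvPolynomial (Fin (ℓ + L + 1)) ℤ)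
      (FractionRing (MvPolynomial (Fin (ℓ + L + 1)) ℤ)) (MvPolynomial.X i) ≠ 0 := fun i => by
    rw [map_ne_zero_iff _ (IsFractionRing.injective _ _)]
    exact MvPolynomial.X_ne_zero _
  rw [h, MvPolynomial.monomial_eq, Finsupp.prod_fintype _ _ (by simp), map_mul, map_prod,
    eq_intCast MvPolynomial.C, map_intCast, mul_left_comm, ← Finset.prod_mul_distrib,
    Finset.prod_eq_one, mul_one]
  intro i _
  rw [map_pow, Finsupp.equivFunOnFinite_symm_apply_apply, ← mul_pow, inv_mul_cancel₀ (hX i),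
    one_pow]
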